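/- A graph $G$ is $B_1$-EPG if there is a family $(P_v)_{v\in V(G)}$ of paths of the rectangular grid $\mathbb Z\times\mathbb Z$, each with at most one bend (change of direction), such that distinct vertices $u,v$ are adjacent in $G$ if and only if $P_u$ and $P_v$ have a common grid edge. Each of the following graphs is a forbidden induced subgraph for the class of $B_1$-EPG graphs, that is, no $B_1$-EPG graph has an induced subgraph isomorphic to it (these graphs are, together with the cycles $C_n$, $n\ge 4$, the minimal forbidden induced subgraphs of vertex intersection graphs of paths in a tree). * $F_1$: a claw with each edge subdivided once, plus a universal vertex. * $F_2$: the $3$-sun plus a universal vertex. * $F_3$: the umbrella (a path on $5$ vertices, a vertex adjacent to all of them, and a pendant vertex at the middle vertex of the path) plus a universal vertex. * $F_4$: the rising sun (a clique $\{a,b,c,d\}$ and pairwise nonadjacent vertices with neighbourhoods $\{a,b\}$, $\{b,c\}$, $\{c,d\}$) plus a universal vertex. * $F_5(n)$, $n\ge 7$: a path on $n-3$ vertices, a vertex $c$ adjacent to all interior vertices of the path, a pendant vertex at $c$, plus a universal vertex. * $F_6$: adjacent vertices $1,2$, both adjacent to the pairwise nonadjacent vertices $3,4,5$, and vertices $6,7,8$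 with neighbourhoods $\{1,3\}$, $\{1,4\}$, $\{2,5\}$. * $F_7$: a triangle $1,2,3$, all of whose vertices are adjacent to the pairwise nonadjacent vertices $4,5,6$, and vertices $7,8,9$ with neighbourhoods $\{2,4\}$, $\{1,5\}$, $\{3,6\}$. * $F_{10}(n)$, $n\ge 8$: adjacent vertices $2,3$; a vertex $1$ with neighbourhood $\{2,3\}$; a path $6,8,9,\dots,n,7$ on $n-5$ vertices, all of them adjacent to both $2$ and $3$; a vertex $4$ with neighbourhood $\{2,6\}$; a vertex $5$ with neighbourhood $\{3,7\}$. * $F_8$: $F_{10}(8)$ plus the edge $48$. $F_9$: $F_{10}(8)$ plus the edges $48$ and $58$. In the remaining graphs, $k\ge 2$; $Q$ is a clique, and an ear at an edge $xy$ of $Q$ is a new vertex with neighbourhood $\{x,y\}$ (except where an additional edge is mentioned); there are no edges other than those described. * $F_{11}(4k)$: the $(2k-1)$-sun, i.e. a clique $Q=\{q_0,\dots,q_{2k-2}\}$ with an ear at each edge $q_iq_{i+1}$ (indices modulo $2k-1$), and two nonadjacent vertices $a,b$, each adjacent to all of $Q$. * $F_{12}(4k)$: $F_{11}(4k)$ plus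 an edge joining one ear to $b$. * $F_{13}(4k+1)$: a clique $Q=\{q_0,\dots,q_{2k-1}\}$, an ear at each $q_iq_{i+1}$, $0\le i\le 2k-2$, and two nonadjacent vertices with neighbourhoods $Q\setminus\{q_0\}$ and $Q\setminus\{q_{2k-1}\}$. * $F_{14}(4k+1)$: the $2k$-sun with clique $Q=\{q_0,\dots,q_{2k-1}\}$, and a vertex with neighbourhood $Q\setminus\{q_0\}$. * $F_{15}(4k+2)$: a clique $Q=\{q_0,\dots,q_{2k}\}$, an ear at each $q_iq_{i+1}$, $0\le i\le 2k-1$, and a vertex with neighbourhood $Q\setminus\{q_0,q_{2k}\}$. * $F_{16}(4k+3)$: a clique $Q=\{q_0,\dots,q_{2k-1}\}$, an ear at each $q_iq_{i+1}$, $0\le i\le 2k-2$, two nonadjacent vertices $a,b$, each adjacent to all of $Q$, a vertex with neighbourhood $\{a,q_0\}$, and a vertex with neighbourhood $\{b,q_{2k-1}\}$. -/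

import Mathlib

open SimpleGraph

/-! ### `B_k`-EPG graphs -/

/-- The rectangular grid: the points are those of `ℤ × ℤ`, and the grid edges join the points at
distance one on a common row or column. -/
def grid : SimpleGraph (ℤ × ℤ) where
  Adj p q := |p.1 - q.1| + |p.2 - q.2| = 1
  symm := ⟨fun p q h => by rw [abs_sub_comm q.1, abs_sub_comm q.2]; exact h⟩
  loopless := ⟨fun p h => by simp at h⟩

/-- A path of the grid (no repeated point), with arbitrary end points. -/
structure GridPath where
  source : ℤ × ℤ
  target : ℤ × ℤ
  toPath : grid.Path source target

namespace GridPath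

/-- The `i`-th point of the path, for `0 ≤ i ≤ length`. -/
def point (P : GridPath) (i : ℕ) : ℤ × ℤ := P.toPath.1.getVert i

/-- The number of bends: the number of pairs of consecutive edges, from the points `i, i + 1` and
`i + 1, i + 2`, that do not lie on a common row or column. -/
def bends (P : GridPath) : ℕ :=
  ((Finset.range (P.toPath.1.length - 1)).filter fun i =>
    (P.point i).1 ≠ (P.point (i + 2)).1 ∧ (P.point i).2 ≠ (P.point (i + 2)).2).card

/-- Two grid paths meet if they have a common grid edge. -/
def ShareEdge (P Q : GridPath) : Prop :=
  ∃ e : Sym2 (ℤ × ℤ), e ∈ P.toPath.1.edges ∧ e ∈ Q.toPath.1.edges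

end GridPath

/-- `G` is `B_k`-EPG: it is the edge intersection graph of a family of grid paths, each of which
has at most `k` bends. -/
def IsBkEPG {V : Type*} (k : ℕ) (G : SimpleGraph V) : Prop :=
  ∃ P : V → GridPath, (∀ v, (P v).bends ≤ k) ∧
    ∀ u v, u ≠ v → (G.Adj u v ↔ (P u).ShareEdge (P v))

/-! ### The forbidden graphs -/

/-- The graph with vertices `1, …, n` (the vertex `i` being the element `i - 1` of `Fin n`) and
with the listed edges. -/
def graphOfEdges (n : ℕ) (l : List (ℕ × ℕ)) : SimpleGraph (Fin n) :=
  SimpleGraph.fromRel fun i j => ((i : ℕ) + 1, (j : ℕ) + 1) ∈ l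

/-- A claw with every edge subdivided (centre `1`), plus the universal vertex `8`. -/
def F1 : SimpleGraph (Fin 8) := graphOfEdges 8
  [(1, 2), (1, 3), (1, 4), (2, 5), (3, 6), (4, 7),
   (8, 1), (8, 2), (8, 3), (8, 4), (8, 5), (8, 6), (8, 7)]

/-- The 3-sun (clique `1, 2, 3`), plus the universal vertex `7`. -/
def F2 : SimpleGraph (Fin 7) := graphOfEdges 7
  [(1, 2), (1, 3), (2, 3), (4, 1), (4, 2), (5, 2), (5, 3), (6, 3), (6, 1),
   (7, 1), (7, 2), (7, 3), (7, 4), (7, 5), (7, 6)]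

/-- The umbrella (a path `1, …, 5`, a vertex `6` adjacent to all of it, and a vertex `7` pendant
at the middle vertex `3` of the path), plus the universal vertex `8`. -/
def F3 : SimpleGraph (Fin 8) := graphOfEdges 8
  [(1, 2), (2, 3), (3, 4), (4, 5), (6, 1), (6, 2), (6, 3), (6, 4), (6, 5), (7, 3),
   (8, 1), (8, 2), (8, 3), (8, 4), (8, 5), (8, 6), (8, 7)]

/-- The rising sun (a clique `1, 2, 3, 4` and vertices `5, 6, 7` adjacent to its edges `12`, `23`
and `34`, respectively), plus the universal vertex `8`. -/
def F4 : SimpleGraph (Fin 8) := graphOfEdges 8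
  [(1, 2), (1, 3), (1, 4), (2, 3), (2, 4), (3, 4), (5, 1), (5, 2), (6, 2), (6, 3), (7, 3), (7, 4),
   (8, 1), (8, 2), (8, 3), (8, 4), (8, 5), (8, 6), (8, 7)]

/-- The vertices of `F5 n`. -/
inductive F5Vertex (n : ℕ)
  | universal
  | apex
  | pendant
  | path (i : Fin (n - 3))

/-- The graph `F₅(n)`, `n ≥ 7`, with `n` vertices: a path of `n - 3` vertices, an apex adjacent to
all the interior vertices of the path, a vertex pendant at the apex, and a universal vertex. -/
def F5 (n : ℕ) : SimpleGraph (F5Vertex n) :=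
  SimpleGraph.fromRel fun u v => match u, v with
    | .universal, _ => True
    | .apex, .pendant => True
    | .apex, .path i => 0 < (i : ℕ) ∧ (i : ℕ) + 1 < n - 3
    | .path i, .path j => (i : ℕ) + 1 = j
    | _, _ => False

/-- `K_2 + 3K_1` (join of the edge `12` and the independent set `3, 4, 5`), and for each of
`3, 4, 5` a further vertex adjacent to it and to one of `1, 2`, not always the same. -/
def F6 : SimpleGraph (Fin 8) := graphOfEdges 8
  [(1, 2), (1, 3), (1, 4), (1, 5), (2, 3), (2, 4), (2, 5),
   (6, 3), (6, 1), (7, 4), (7, 1), (8, 5), (8, 2)]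

/-- The join of the triangle `1, 2, 3` and the independent set `4, 5, 6`, and for each of `4, 5, 6`
a further vertex adjacent to it and to one of `1, 2, 3`, always a different one. -/
def F7 : SimpleGraph (Fin 9) := graphOfEdges 9
  [(1, 2), (1, 3), (2, 3), (1, 4), (1, 5), (1, 6), (2, 4), (2, 5), (2, 6), (3, 4), (3, 5), (3, 6),
   (7, 4), (7, 2), (8, 5), (8, 1), (9, 6), (9, 3)]

/-- `F₁₀(8)` with the additional edge `48`. -/
def F8 : SimpleGraph (Fin 8) := graphOfEdges 8
  [(2, 3), (1, 2), (1, 3), (2, 6), (2, 7), (2, 8), (3, 6), (3, 7), (3, 8), (6, 8), (7, 8),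
   (4, 2), (4, 6), (5, 3), (5, 7), (4, 8)]

/-- `F₁₀(8)` with the additional edges `48` and `58`. -/
def F9 : SimpleGraph (Fin 8) := graphOfEdges 8
  [(2, 3), (1, 2), (1, 3), (2, 6), (2, 7), (2, 8), (3, 6), (3, 7), (3, 8), (6, 8), (7, 8),
   (4, 2), (4, 6), (5, 3), (5, 7), (4, 8), (5, 8)]

/-- The vertices of `F10 n`. -/
inductive F10Vertex (n : ℕ)
  | v1
  | v2
  | v3
  | v4
  | v5
  | path (i : Fin (n - 5))

/-- The graph `F₁₀(n)`, `n ≥ 8`, with `n` vertices: the adjacent vertices `2, 3` are adjacent to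
the vertex `1` and to all the vertices of a path `6, 8, 9, …, n, 7` of `n - 5` vertices; the vertex
`4` is adjacent to `2` and to the first vertex of the path, the vertex `5` to `3` and to the last
one. -/
def F10 (n : ℕ) : SimpleGraph (F10Vertex n) :=
  SimpleGraph.fromRel fun u v => match u, v with
    | .v2, .v3 => True
    | .v1, .v2 => True
    | .v1, .v3 => True
    | .v2, .path _ => True
    | .v3, .path _ => True
    | .path i, .path j => (i : ℕ) + 1 = j
    | .v4, .v2 => True
    | .v4, .path i => (i : ℕ) = 0
    | .v5, .v3 => True
    | .v5, .path i => (i : ℕ) + 1 = n - 5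
    | _, _ => False

/-- Vertices of the graphs `F11` to `F16`: `m` vertices of a clique, `e` ears and `t` further
vertices. -/
inductive EarVertex (m e t : ℕ)
  | clique (i : Fin m)
  | ear (i : Fin e)
  | extra (i : Fin t)

/-- The clique vertices are pairwise adjacent, the ear `i` is adjacent to the clique vertices
`i` and `i + 1` (modulo `m`), and the other adjacencies are those given by `r`. -/
def earGraph (m e t : ℕ) (r : EarVertex m e t → EarVertex m e t → Prop) :
    SimpleGraph (EarVertex m e t) :=
  SimpleGraph.fromRel fun u v => match u, v with
    | .clique _, .clique _ => True
    | .ear i, .clique j => (j : ℕ) = (i : ℕ) ∨ (j : ℕ) = ((i : ℕ) + 1) % m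
    | u, v => r u v

/-- The graph `F₁₁(4k)`, `k ≥ 2`: the `(2k-1)`-sun, and two nonadjacent vertices adjacent to all
the vertices of its clique. -/
def F11 (k : ℕ) : SimpleGraph (EarVertex (2 * k - 1) (2 * k - 1) 2) :=
  earGraph _ _ _ fun u v => match u, v with
    | .extra _, .clique _ => True
    | _, _ => False

/-- The graph `F₁₂(4k)`, `k ≥ 2`: `F₁₁(4k)`, and an edge between one ear and one of the two further
vertices. -/
def F12 (k : ℕ) : SimpleGraph (EarVertex (2 * k - 1) (2 * k - 1) 2) :=
  earGraph _ _ _ fun u v => match u, v with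
    | .extra _, .clique _ => True
    | .ear i, .extra s => (i : ℕ) = 0 ∧ s = 1
    | _, _ => False

/-- The graph `F₁₃(4k+1)`, `k ≥ 2`: a clique `0, …, 2k-1`, an ear at each edge of the path
`0, …, 2k-1`, and two nonadjacent further vertices, one adjacent to all the clique vertices but
`0`, the other to all but `2k-1`. -/
def F13 (k : ℕ) : SimpleGraph (EarVertex (2 * k) (2 * k - 1) 2) :=
  earGraph _ _ _ fun u v => match u, v with
    | .extra s, .clique j => (s = 0 ∧ (j : ℕ) ≠ 0) ∨ (s = 1 ∧ (j : ℕ) ≠ 2 * k - 1)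
    | _, _ => False

/-- The graph `F₁₄(4k+1)`, `k ≥ 2`: the `2k`-sun, and a further vertex adjacent to all the clique
vertices but one. -/
def F14 (k : ℕ) : SimpleGraph (EarVertex (2 * k) (2 * k) 1) :=
  earGraph _ _ _ fun u v => match u, v with
    | .extra _, .clique j => (j : ℕ) ≠ 0
    | _, _ => False

/-- The graph `F₁₅(4k+2)`, `k ≥ 2`: a clique `0, …, 2k`, an ear at each edge of the path
`0, …, 2k`, and a further vertex adjacent to all the clique vertices but `0` and `2k`. -/
def F15 (k : ℕ) : SimpleGraph (EarVertex (2 * k + 1) (2 * k) 1) :=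
  earGraph _ _ _ fun u v => match u, v with
    | .extra _, .clique j => (j : ℕ) ≠ 0 ∧ (j : ℕ) ≠ 2 * k
    | _, _ => False

/-- The graph `F₁₆(4k+3)`, `k ≥ 2`: a clique `0, …, 2k-1`, an ear at each edge of the path
`0, …, 2k-1`, two nonadjacent vertices `0', 1'` adjacent to all the clique vertices, a vertex `2'`
adjacent to `0` and `0'`, and a vertex `3'` adjacent to `2k-1` and `1'`. -/
def F16 (k : ℕ) : SimpleGraph (EarVertex (2 * k) (2 * k - 1) 4) :=
  earGraph _ _ _ fun u v => match u, v with
    | .extra s, .clique j => s = 0 ∨ s = 1 ∨ (s = 2 ∧ (j : ℕ) = 0) ∨ (s = 3 ∧ (j : ℕ) = 2 * k - 1)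
    | .extra s, .extra t => (s = 2 ∧ t = 0) ∨ (s = 3 ∧ t = 1)
    | _, _ => False

/-! A path with at most one bend is a hook: a horizontal and a vertical arm meeting at a corner.
Hooks are geodesics for the `ℓ¹` distance, so a hook is determined up to orientation by its point
set, and sharing a grid edge means sharing two points at distance one. Two further facts hold: hooks
sharing an edge meet in a connected set, and three hooks that pairwise share edges have a common
point. These facts make up `GeodesicModel`, and nothing else about the grid is used for the
forbidden graphs.

A coordinate along the path of `v` (`Chart`) turns the neighbours of `v` into intervals of positive
length. Adjacent neighbours give touching intervals (`Chart.touch`), nonadjacent ones give intervals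
with disjoint interiors (`Chart.disjoint`). Distances are `ℓ¹`, hence do not depend on the path
along which they are read, so orders seen on different paths can be compared. There are four kinds
of contradiction.

`F1` to `F5`: neighbours of `v` joined by a walk in the neighbourhood of `v` that avoids `b` and its
neighbours lie on the same side of `b`. So the neighbourhood of a vertex has no asteroidal triple,
whereas the universal vertex sees one.

`F6`, `F7`: of three independent common neighbours of a clique, the same one is in the middle on all
paths of the clique (`exists_common_middle`). The further vertex attached to the middle one and to
only one member of the clique has no room (`Chart.not_middle`).

`F8` to `F10`: from a common point of `o`, `u`, `v`, the vertex `y` is nearer than `x` along `v`,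
but `x` is nearer than `y` along `u` (`false_of_crossing`).

`F11` to `F16`: a clique with two nonadjacent common neighbours has a common grid edge from `p` to
`p'` (`exists_common_edge`). A vertex whose path avoids this edge but which is adjacent to a path
through it lies on a well-defined side of it (`Chart.side`), and consecutive ears lie on opposite
sides (`EarSystem.beyond_ear_iff`). The further vertices force a contradiction with parity; for
`F16`, a comparison of distances is needed as well. -/

/-! ### One-bend grid paths as hooks -/

/-- The `ℓ¹` distance of the grid. -/
def gdist (r s : ℤ × ℤ) : ℤ := (r.1 - s.1).natAbs + (r.2 - s.2).natAbs

theorem grid_adj {r s : ℤ × ℤ} : grid.Adj r s ↔ gdist r s = 1 := by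
  simp [grid, gdist]

/-- The point set of a path with at most one bend: the corner is `(X, Y)`, the horizontal arm ends
at `(H, Y)` and the vertical arm at `(X, W)`. -/
def InHook (X Y H W : ℤ) (r : ℤ × ℤ) : Prop :=
  (r.2 = Y ∧ ((X ≤ r.1 ∧ r.1 ≤ H) ∨ (H ≤ r.1 ∧ r.1 ≤ X))) ∨
    (r.1 = X ∧ ((Y ≤ r.2 ∧ r.2 ≤ W) ∨ (W ≤ r.2 ∧ r.2 ≤ Y)))

theorem gdist_comm (r s : ℤ × ℤ) : gdist r s = gdist s r := by
  unfold gdist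
  omega

theorem gdist_swap (r s : ℤ × ℤ) : gdist r.swap s.swap = gdist r s := by
  simp [gdist, add_comm]

theorem inHook_swap (X Y H W : ℤ) (r : ℤ × ℤ) : InHook Y X W H r.swap ↔ InHook X Y H W r := by
  simp [InHook, or_comm]

theorem eq_of_gdist_eq_zero {r s : ℤ × ℤ} (h : gdist r s = 0) : r = s := by
  unfold gdist at h
  ext <;> omega

/-- A sequence of grid points with unit steps and without bends or repetitions is an arithmetic
progression. -/
theorem eq_add_mul_of_noBend (f : ℕ → ℤ × ℤ) (s t : ℕ)
    (hstep : ∀ i, s ≤ i → i < t → gdist (f i) (f (i + 1)) = 1)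
    (hne : ∀ i, s ≤ i → i + 2 ≤ t → f i ≠ f (i + 2))
    (hb : ∀ i, s ≤ i → i + 2 ≤ t → (f i).1 = (f (i + 2)).1 ∨ (f i).2 = (f (i + 2)).2)
    (i : ℕ) (hi : s + i ≤ t) :
    f (s + i) = ((f s).1 + i * ((f (s + 1)).1 - (f s).1),
      (f s).2 + i * ((f (s + 1)).2 - (f s).2)) := by
  induction i using Nat.twoStepInduction with
  | zero => simp
  | one => simp
  | more i ih1 ih2 =>
    have h1 := ih1 (by omega)
    have h2 := ih2 (by omega)
    have e1 := hstep (s + i) (by omega) (by omega)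
    have e2 := hstep (s + i + 1) (by omega) (by omega)
    rw [show s + i + 1 + 1 = s + i + 2 by omega] at e2
    have e3 := hb (s + i) (by omega) (by omega)
    have e4 := hne (s + i) (by omega) (by omega)
    -- Two unit steps that neither bend nor turn back are equal.
    have key : (f (s + i + 2)).1 = 2 * (f (s + i + 1)).1 - (f (s + i)).1 ∧
        (f (s + i + 2)).2 = 2 * (f (s + i + 1)).2 - (f (s + i)).2 := by
      rw [ne_eq, Prod.ext_iff] at e4
      unfold gdist at e1 e2
      omega
    rw [show s + (i + 1) = s + i + 1 by omega] at h2
    rw [show s + (i + 2) = s + i + 2 by omega]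
    ext
    · rw [key.1, h1, h2]; push_cast; ring
    · rw [key.2, h1, h2]; push_cast; ring

theorem gdist_eq_one {r s : ℤ × ℤ} (h : gdist r s = 1) :
    (s.2 = r.2 ∧ (s.1 - r.1 = 1 ∨ s.1 - r.1 = -1)) ∨
      (s.1 = r.1 ∧ (s.2 - r.2 = 1 ∨ s.2 - r.2 = -1)) := by
  unfold gdist at h
  omega

/-- A horizontal arm, of length `c`, followed by a vertical arm. -/
def IsHookParam (f : ℕ → ℤ × ℤ) (n : ℕ) : Prop :=
  ∃ (X Y ε δ : ℤ) (c : ℕ), c ≤ n ∧ (ε = 1 ∨ ε = -1) ∧ (δ = 1 ∨ δ = -1) ∧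
    (∀ i : ℕ, i ≤ c → f i = (X + ε * (c - i), Y)) ∧
    ∀ i : ℕ, c ≤ i → i ≤ n → f i = (X, Y + δ * (i - c))

/-- The arms are the arithmetic progressions up to and from the index `b + 1`. A path that starts
vertically is handled by swapping the coordinates. A path without bends is a hook whose second arm
is a single point. -/
theorem isHookParam_of_bends (f : ℕ → ℤ × ℤ) (n : ℕ)
    (hstep : ∀ i, i < n → gdist (f i) (f (i + 1)) = 1)
    (hne : ∀ i, i + 2 ≤ n → f i ≠ f (i + 2)) (b : ℕ)
    (hb : ∀ i, i + 2 ≤ n → i ≠ b → (f i).1 = (f (i + 2)).1 ∨ (f i).2 = (f (i + 2)).2) :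
    IsHookParam f n ∨ IsHookParam (Prod.swap ∘ f) n := by
  by_cases hbend : b + 2 ≤ n ∧ (f b).1 ≠ (f (b + 2)).1 ∧ (f b).2 ≠ (f (b + 2)).2
  · obtain ⟨hbn, hb1, hb2⟩ := hbend
    have A := eq_add_mul_of_noBend f 0 (b + 1) (fun i _ _ => hstep i (by omega))
      (fun i _ _ => hne i (by omega)) (fun i _ _ => hb i (by omega) (by omega))
    have B := eq_add_mul_of_noBend f (b + 1) n (fun i _ _ => hstep i (by omega))
      (fun i _ _ => hne i (by omega)) (fun i _ _ => hb i (by omega) (by omega))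
    simp only [zero_add] at A
    have Ab := A b (by omega)
    have Ab1 := A (b + 1) (by omega)
    have s0 := gdist_eq_one (hstep 0 (by omega))
    have s1 := gdist_eq_one (hstep (b + 1) (by omega))
    have B1 := B 1 (by omega)
    rw [show b + 1 + 1 = b + 2 by omega] at s1 B B1
    rcases s0 with ⟨h0, h0'⟩ | ⟨h0, h0'⟩
    · left
      rw [zero_add] at h0
      rw [h0] at Ab Ab1
      have : (f (b + 2)).1 = (f (b + 1)).1 := by
        have : (f b).2 = (f (b + 1)).2 := by rw [Ab, Ab1]; simp
        omega
      refine ⟨(f (b + 1)).1, (f (b + 1)).2, -((f (0 + 1)).1 - (f 0).1),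
        (f (b + 2)).2 - (f (b + 1)).2, b + 1, by omega, by omega, by omega, ?_, ?_⟩
      · intro i hi
        rw [A i (by omega), Ab1, h0]
        ext
        · push_cast; ring_nf
        · simp
      · intro i hi hi'
        obtain ⟨j, rfl⟩ := Nat.exists_eq_add_of_le hi
        rw [B j hi', this]
        ext
        · simp
        · push_cast; ring
    · right
      rw [zero_add] at h0
      rw [h0] at Ab Ab1
      have : (f (b + 2)).2 = (f (b + 1)).2 := by
        have : (f b).1 = (f (b + 1)).1 := by rw [Ab, Ab1]; simp
        omega
      refine ⟨(f (b + 1)).2, (f (b + 1)).1, -((f (0 + 1)).2 - (f 0).2),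
        (f (b + 2)).1 - (f (b + 1)).1, b + 1, by omega, by omega, by omega, ?_, ?_⟩
      · intro i hi
        rw [Function.comp, A i (by omega), Ab1, h0]
        ext
        · push_cast; simp only [Prod.swap]; ring_nf
        · simp
      · intro i hi hi'
        obtain ⟨j, rfl⟩ := Nat.exists_eq_add_of_le hi
        rw [Function.comp, B j hi', this]
        ext
        · simp
        · push_cast; simp only [Prod.swap]; ring
  · have A := eq_add_mul_of_noBend f 0 n (fun i _ _ => hstep i (by omega))
      (fun i _ _ => hne i (by omega)) (fun i _ hi => by
        by_cases h : i = b
        · subst h; tauto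
        · exact hb i hi h)
    simp only [zero_add] at A
    rcases Nat.eq_zero_or_pos n with rfl | hn
    · left
      refine ⟨(f 0).1, (f 0).2, 1, 1, 0, le_rfl, by simp, by simp, ?_, ?_⟩
      · intro i hi
        obtain rfl : i = 0 := by omega
        simp
      · intro i _ hi
        obtain rfl : i = 0 := by omega
        simp
    rcases gdist_eq_one (hstep 0 hn) with ⟨h0, h0'⟩ | ⟨h0, h0'⟩ <;> rw [zero_add] at h0 h0'
    · left
      have hA : ∀ i : ℕ, i ≤ n → f i = ((f 0).1 + i * ((f 1).1 - (f 0).1), (f 0).2) := by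
        intro i hi; rw [A i hi, h0]; simp
      refine ⟨(f n).1, (f n).2, -((f 1).1 - (f 0).1), 1, n, le_rfl, by omega, by simp, ?_, ?_⟩
      · intro i hi
        rw [hA i hi, hA n le_rfl]
        ext
        · simp only; ring
        · rfl
      · intro i hi hi'
        obtain rfl : i = n := by omega
        simp
    · right
      have hA : ∀ i : ℕ, i ≤ n → f i = ((f 0).1, (f 0).2 + i * ((f 1).2 - (f 0).2)) := by
        intro i hi; rw [A i hi, h0]; simp
      refine ⟨(f n).2, (f n).1, -((f 1).2 - (f 0).2), 1, n, le_rfl, by omega, by simp, ?_, ?_⟩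
      · intro i hi
        rw [Function.comp, hA i hi, hA n le_rfl]
        ext
        · simp only [Prod.swap]; ring
        · rfl
      · intro i hi hi'
        obtain rfl : i = n := by omega
        simp [Prod.swap]

theorem IsHookParam.exists_inHook {f : ℕ → ℤ × ℤ} {n : ℕ} (hf : IsHookParam f n) :
    ∃ X Y H W, ∀ r, (∃ i ≤ n, f i = r) ↔ InHook X Y H W r := by
  obtain ⟨X, Y, ε, δ, c, hc, hε, hδ, h1, h2⟩ := hf
  refine ⟨X, Y, X + ε * c, Y + δ * (n - c), fun r => ⟨?_, ?_⟩⟩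
  · rintro ⟨i, hi, rfl⟩
    rcases le_total i c with hic | hic
    · rw [h1 i hic]
      left
      rcases hε with rfl | rfl <;> simp only [true_and] <;> omega
    · rw [h2 i hic hi]
      right
      rcases hδ with rfl | rfl <;> simp only [true_and] <;> omega
  · obtain ⟨x, y⟩ := r
    rintro (⟨h, h'⟩ | ⟨h, h'⟩) <;> simp only at h h' <;> subst h
    · refine ⟨c - (x - X).natAbs, by omega, ?_⟩
      rw [h1 _ (by omega)]
      rcases hε with rfl | rfl <;> ext <;> simp only <;> omega
    · refine ⟨c + (y - Y).natAbs, ?_, ?_⟩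
      · rcases hδ with rfl | rfl <;> omega
      rw [h2 _ (by omega) (by rcases hδ with rfl | rfl <;> omega)]
      rcases hδ with rfl | rfl <;> ext <;> simp only <;> omega

/-- Both coordinates are monotone along a hook, so the `ℓ¹` lengths of its steps add up. -/
theorem IsHookParam.gdist_eq {f : ℕ → ℤ × ℤ} {n : ℕ} (hf : IsHookParam f n) {i j : ℕ}
    (hij : i ≤ j) (hj : j ≤ n) : gdist (f i) (f j) = j - i := by
  obtain ⟨X, Y, ε, δ, c, hc, hε, hδ, h1, h2⟩ := hf
  unfold gdist
  rcases le_total i c with hi | hi <;> rcases le_total j c with hj' | hj' <;>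
    simp only [h1 i, h2 i, h1 j, h2 j, hi, hj', hj, hij.trans hj] <;>
    rcases hε with rfl | rfl <;> rcases hδ with rfl | rfl <;> omega

theorem GridPath.isHookParam (P : GridPath) (hP : P.bends ≤ 1) :
    IsHookParam P.point P.toPath.1.length ∨
      IsHookParam (Prod.swap ∘ P.point) P.toPath.1.length := by
  unfold GridPath.bends at hP
  obtain ⟨b, hb⟩ := Finset.card_le_one_iff_subset_singleton.1 hP
  refine isHookParam_of_bends _ _ (fun i hi => grid_adj.1 (P.toPath.1.adj_getVert_succ hi)) ?_ b ?_
  · intro i hi h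
    have := P.toPath.2.getVert_injOn (by simp; omega) (by simpa using hi) h
    omega
  · intro i hi hib
    by_contra! h
    exact hib (Finset.mem_singleton.1 (hb (by simpa using ⟨by omega, h⟩)))

theorem GridPath.mem_support_iff (P : GridPath) (r : ℤ × ℤ) :
    r ∈ P.toPath.1.support ↔ ∃ i ≤ P.toPath.1.length, P.point i = r := by
  rw [Walk.mem_support_iff_exists_getVert]
  exact ⟨fun ⟨i, h, h'⟩ => ⟨i, h', h⟩, fun ⟨i, h, h'⟩ => ⟨i, h', h⟩⟩

theorem GridPath.exists_inHook (P : GridPath) (hP : P.bends ≤ 1) :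
    ∃ X Y H W, ∀ r, r ∈ P.toPath.1.support ↔ InHook X Y H W r := by
  rcases P.isHookParam hP with h | h
  · obtain ⟨X, Y, H, W, h⟩ := h.exists_inHook
    exact ⟨X, Y, H, W, fun r => by rw [P.mem_support_iff, h]⟩
  · obtain ⟨X, Y, H, W, h⟩ := h.exists_inHook
    refine ⟨Y, X, W, H, fun r => ?_⟩
    rw [P.mem_support_iff, ← inHook_swap, ← h]
    simp [Function.comp, Prod.swap_inj]

/-- Distance along the path equals `ℓ¹` distance, so points of the path at distance one are
consecutive. This reduces edge intersection to a statement about point sets. -/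
theorem GridPath.mk_mem_edges_iff (P : GridPath) (hP : P.bends ≤ 1) (r s : ℤ × ℤ) :
    s(r, s) ∈ P.toPath.1.edges ↔
      r ∈ P.toPath.1.support ∧ s ∈ P.toPath.1.support ∧ gdist r s = 1 := by
  constructor
  · intro h
    exact ⟨Walk.fst_mem_support_of_mem_edges _ h, Walk.snd_mem_support_of_mem_edges _ h,
      grid_adj.1 (Walk.adj_of_mem_edges _ h)⟩
  · rintro ⟨hr, hs, h⟩
    obtain ⟨i, hi, rfl⟩ := (P.mem_support_iff r).1 hr
    obtain ⟨j, hj, rfl⟩ := (P.mem_support_iff s).1 hs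
    have key : ∀ i j, i ≤ j → j ≤ P.toPath.1.length → gdist (P.point i) (P.point j) = j - i := by
      intro i j hij hj
      rcases P.isHookParam hP with h | h
      · exact h.gdist_eq hij hj
      · rw [← gdist_swap]; exact h.gdist_eq hij hj
    have edge : ∀ i < P.toPath.1.length, s(P.point i, P.point (i + 1)) ∈ P.toPath.1.edges := by
      intro i hi
      exact (Walk.mk_mem_edges_iff_exists _).2 ⟨i, hi, rfl⟩
    rcases le_total i j with hij | hij
    · rw [key i j hij hj] at h
      obtain rfl : j = i + 1 := by omega
      exact edge i (by omega)
    · rw [gdist_comm, key j i hij hi] at h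
      obtain rfl : i = j + 1 := by omega
      rw [Sym2.eq_swap]
      exact edge j (by omega)

/-! ### Geodesic models -/

/-- A representation of `G` by paths of the grid that are geodesic for the `ℓ¹` distance, adjacent
vertices having paths with a connected intersection, and pairwise adjacent triples having paths with
a common point. -/
structure GeodesicModel {V : Type*} (G : SimpleGraph V) where
  pts : V → Set (ℤ × ℤ)
  nonempty : ∀ v, (pts v).Nonempty
  exists_pos : ∀ v, ∃ pos : ℤ × ℤ → ℤ,
    (∀ r ∈ pts v, ∀ s ∈ pts v, gdist r s = (pos r - pos s).natAbs) ∧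
    (∀ r ∈ pts v, ∀ t ∈ pts v, ∀ k, pos r ≤ k → k ≤ pos t → ∃ s ∈ pts v, pos s = k) ∧
    ∃ B, ∀ r ∈ pts v, -B ≤ pos r ∧ pos r ≤ B
  adj_iff : ∀ {u v}, u ≠ v →
    (G.Adj u v ↔ ∃ r s, r ∈ pts u ∧ r ∈ pts v ∧ s ∈ pts u ∧ s ∈ pts v ∧ gdist r s = 1)
  convex : ∀ {u v}, G.Adj u v → ∀ {r s t}, r ∈ pts u → r ∈ pts v → t ∈ pts u → t ∈ pts v →
    s ∈ pts u → gdist r s + gdist s t = gdist r t → s ∈ pts v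
  helly : ∀ {u v w}, G.Adj u v → G.Adj v w → G.Adj u w → ∃ r, r ∈ pts u ∧ r ∈ pts v ∧ r ∈ pts w

/-- Two hooks share a horizontal grid edge. -/
def ShareRow (X Y H X' Y' H' : ℤ) : Prop :=
  Y = Y' ∧ ∃ i, ((X ≤ i ∧ i < H) ∨ (H ≤ i ∧ i < X)) ∧ ((X' ≤ i ∧ i < H') ∨ (H' ≤ i ∧ i < X'))

theorem share_iff {X Y H W X' Y' H' W' : ℤ} :
    (∃ r s, InHook X Y H W r ∧ InHook X' Y' H' W' r ∧ InHook X Y H W s ∧ InHook X' Y' H' W' s ∧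
      gdist r s = 1) ↔ ShareRow X Y H X' Y' H' ∨ ShareRow Y X W Y' X' W' := by
  constructor
  · rintro ⟨r, s, h1, h2, h3, h4, h⟩
    rcases gdist_eq_one h with ⟨e, h⟩ | ⟨e, h⟩
    · left
      unfold InHook at *
      refine ⟨by omega, min r.1 s.1, ?_, ?_⟩ <;> omega
    · right
      unfold InHook at *
      refine ⟨by omega, min r.2 s.2, ?_, ?_⟩ <;> omega
  · rintro (⟨rfl, i, h, h'⟩ | ⟨rfl, i, h, h'⟩)
    · refine ⟨(i, Y), (i + 1, Y), Or.inl ?_, Or.inl ?_, Or.inl ?_, Or.inl ?_, ?_⟩ <;>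
        simp [gdist] <;> omega
    · refine ⟨(X, i), (X, i + 1), Or.inr ?_, Or.inr ?_, Or.inr ?_, Or.inr ?_, ?_⟩ <;>
        simp [gdist] <;> omega

/-- A common point off the common row lies on both vertical arms, so the columns agree and the two
corners coincide; the arms are then compared separately. If there is no such point, the intersection
is an interval of the row. Without a shared edge this fails, as two hooks may cross twice. -/
theorem hook_convex_of_shareRow {X Y H W X' Y' H' W' : ℤ} (h : ShareRow X Y H X' Y' H')
    {r s t : ℤ × ℤ} (hr : InHook X Y H W r) (hr' : InHook X' Y' H' W' r)
    (ht : InHook X Y H W t) (ht' : InHook X' Y' H' W' t) (hs : InHook X Y H W s)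
    (hd : gdist r s + gdist s t = gdist r t) : InHook X' Y' H' W' s := by
  obtain ⟨rfl, i, h, h'⟩ := h
  obtain ⟨r1, r2⟩ := r
  obtain ⟨s1, s2⟩ := s
  obtain ⟨t1, t2⟩ := t
  unfold gdist at hd
  unfold InHook at *
  simp only at *
  have h1 : (r1 ≤ s1 ∧ s1 ≤ t1) ∨ (t1 ≤ s1 ∧ s1 ≤ r1) := by omega
  have h2 : (r2 ≤ s2 ∧ s2 ≤ t2) ∨ (t2 ≤ s2 ∧ s2 ≤ r2) := by omega
  clear hd
  rcases hr with ⟨rfl, hr⟩ | ⟨rfl, hr⟩ <;> rcases ht with ⟨ht0, ht⟩ | ⟨ht0, ht⟩ <;>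
    rcases hr' with ⟨hr0, hr'⟩ | ⟨hr0, hr'⟩ <;> rcases ht' with ⟨ht0', ht'⟩ | ⟨ht0', ht'⟩ <;>
    omega

/-- All three horizontal arms lie on one row, and they are pairwise intersecting intervals there. -/
theorem hook_helly_of_shareRow {X₁ Y₁ H₁ W₁ X₂ Y₂ H₂ W₂ X₃ Y₃ H₃ W₃ : ℤ}
    (h12 : ShareRow X₁ Y₁ H₁ X₂ Y₂ H₂) (h23 : ShareRow X₂ Y₂ H₂ X₃ Y₃ H₃)
    (h13 : ShareRow X₁ Y₁ H₁ X₃ Y₃ H₃ ∨ ShareRow Y₁ X₁ W₁ Y₃ X₃ W₃) :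
    ∃ r, InHook X₁ Y₁ H₁ W₁ r ∧ InHook X₂ Y₂ H₂ W₂ r ∧ InHook X₃ Y₃ H₃ W₃ r := by
  obtain ⟨rfl, i, hi, hi'⟩ := h12
  obtain ⟨rfl, j, hj, hj'⟩ := h23
  have h : ∃ k, ((X₁ ≤ k ∧ k ≤ H₁) ∨ (H₁ ≤ k ∧ k ≤ X₁)) ∧
      ((X₃ ≤ k ∧ k ≤ H₃) ∨ (H₃ ≤ k ∧ k ≤ X₃)) := by
    rcases h13 with ⟨-, k, h, h'⟩ | ⟨h, -⟩
    · exact ⟨k, by omega, by omega⟩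
    -- A shared vertical edge puts the two hooks in the same column as well, so they have the same
    -- corner.
    · exact ⟨X₁, by omega, by omega⟩
  obtain ⟨k, hk, hk'⟩ := h
  -- The largest of the left ends lies in all three intervals.
  refine ⟨(max (min X₁ H₁) (max (min X₂ H₂) (min X₃ H₃)), Y₁), Or.inl ⟨rfl, ?_⟩,
    Or.inl ⟨rfl, ?_⟩, Or.inl ⟨rfl, ?_⟩⟩ <;> simp only <;> omega

theorem IsBkEPG.nonempty_geodesicModel {V : Type*} {G : SimpleGraph V} (hG : IsBkEPG 1 G) :
    Nonempty (GeodesicModel G) := by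
  obtain ⟨P, hP, hadj⟩ := hG
  choose X Y H W hook using fun v => (P v).exists_inHook (hP v)
  have key : ∀ {u v}, u ≠ v → (G.Adj u v ↔
      ShareRow (X u) (Y u) (H u) (X v) (Y v) (H v) ∨
        ShareRow (Y u) (X u) (W u) (Y v) (X v) (W v)) := by
    intro u v huv
    rw [hadj u v huv, ← share_iff]
    constructor
    · rintro ⟨e, he, he'⟩
      induction e with | _ r s
      rw [GridPath.mk_mem_edges_iff _ (hP _), hook, hook] at he he'
      exact ⟨r, s, he.1, he'.1, he.2.1, he'.2.1, he.2.2⟩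
    · rintro ⟨r, s, h1, h2, h3, h4, h⟩
      refine ⟨s(r, s), ?_, ?_⟩ <;> rw [GridPath.mk_mem_edges_iff _ (hP _), hook, hook]
      exacts [⟨h1, h3, h⟩, ⟨h2, h4, h⟩]
  have swap : ∀ {X Y H W : ℤ} {r : ℤ × ℤ}, InHook X Y H W r → InHook Y X W H r.swap :=
    fun h => (inHook_swap _ _ _ _ _).2 h
  refine ⟨⟨fun v => {r | InHook (X v) (Y v) (H v) (W v) r}, ?_, ?_, ?_, ?_, ?_⟩⟩
  · exact fun v => ⟨(X v, Y v), Or.inl ⟨rfl, by simp only; omega⟩⟩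
  · intro v
    simp only [Set.mem_ofPred_eq]
    generalize X v = X, Y v = Y, H v = H, W v = W
    -- Signed distance from the corner: negative on the horizontal arm, positive on the vertical
    -- one.
    refine ⟨fun r => (r.2 - Y).natAbs - (r.1 - X).natAbs, ?_, ?_,
      (H - X).natAbs + (W - Y).natAbs, ?_⟩
    · intro r hr s hs
      unfold InHook at hr hs
      unfold gdist
      beta_reduce
      omega
    · intro r hr t ht k hk hk'
      by_cases hk0 : k ≤ 0
      · rcases le_total X H with h | h
        · refine ⟨(X - k, Y), Or.inl ⟨rfl, ?_⟩, ?_⟩ <;> unfold InHook at hr ht <;> simp only at * <;>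
            omega
        · refine ⟨(X + k, Y), Or.inl ⟨rfl, ?_⟩, ?_⟩ <;> unfold InHook at hr ht <;> simp only at * <;>
            omega
      · rcases le_total Y W with h | h
        · refine ⟨(X, Y + k), Or.inr ⟨rfl, ?_⟩, ?_⟩ <;> unfold InHook at hr ht <;> simp only at * <;>
            omega
        · refine ⟨(X, Y - k), Or.inr ⟨rfl, ?_⟩, ?_⟩ <;> unfold InHook at hr ht <;> simp only at * <;>
            omega
    · intro r hr
      unfold InHook at hr
      beta_reduce
      omega
  · intro u v huv
    rw [key huv, ← share_iff]
    rfl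
  · intro u v huv r s t hr hr' ht ht' hs hd
    rcases (key huv.ne).1 huv with h | h
    · exact hook_convex_of_shareRow h hr hr' ht ht' hs hd
    · rw [← gdist_swap r s, ← gdist_swap s t, ← gdist_swap r t] at hd
      exact (inHook_swap _ _ _ _ _).1
        (hook_convex_of_shareRow h (swap hr) (swap hr') (swap ht) (swap ht') (swap hs) hd)
  · intro u v w huv hvw huw
    have vert : ∀ {a b c}, G.Adj a c →
        ShareRow (Y a) (X a) (W a) (Y b) (X b) (W b) →
        ShareRow (Y b) (X b) (W b) (Y c) (X c) (W c) →
        ∃ r, InHook (X a) (Y a) (H a) (W a) r ∧ InHook (X b) (Y b) (H b) (W b) r ∧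
          InHook (X c) (Y c) (H c) (W c) r := by
      intro a b c hac h1 h2
      obtain ⟨r, h1, h2, h3⟩ := hook_helly_of_shareRow h1 h2 ((key hac.ne).1 hac).symm
      exact ⟨r.swap, swap h1, swap h2, swap h3⟩
    have hor : ∀ {a b c}, G.Adj a c →
        ShareRow (X a) (Y a) (H a) (X b) (Y b) (H b) →
        ShareRow (X b) (Y b) (H b) (X c) (Y c) (H c) →
        ∃ r, InHook (X a) (Y a) (H a) (W a) r ∧ InHook (X b) (Y b) (H b) (W b) r ∧
          InHook (X c) (Y c) (H c) (W c) r :=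
      fun hac h1 h2 => hook_helly_of_shareRow h1 h2 ((key hac.ne).1 hac)
    -- Of the edges shared by the three pairs, two have the same direction; the two pairs concerned
    -- have one vertex in common, which plays the middle role in `hook_helly_of_shareRow`.
    rcases (key huv.ne).1 huv with h1 | h1 <;> rcases (key hvw.ne).1 hvw with h2 | h2
    · exact hor huw h1 h2
    · rcases (key huw.symm.ne).1 huw.symm with h3 | h3
      · obtain ⟨r, h1, h2, h3⟩ := hor hvw.symm h3 h1
        exact ⟨r, h2, h3, h1⟩
      · obtain ⟨r, h1, h2, h3⟩ := vert huv.symm h2 h3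
        exact ⟨r, h3, h1, h2⟩
    · rcases (key huw.symm.ne).1 huw.symm with h3 | h3
      · obtain ⟨r, h1, h2, h3⟩ := hor huv.symm h2 h3
        exact ⟨r, h3, h1, h2⟩
      · obtain ⟨r, h1, h2, h3⟩ := vert hvw.symm h3 h1
        exact ⟨r, h2, h3, h1⟩
    · exact vert huw h1 h2

theorem IsBkEPG.of_isIndContained {V W : Type*} {k : ℕ} {G : SimpleGraph V} {F : SimpleGraph W}
    (hG : IsBkEPG k G) (h : F ⊴ G) : IsBkEPG k F := by
  obtain ⟨f⟩ := h
  obtain ⟨P, hP, hadj⟩ := hG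
  exact ⟨P ∘ f, fun v => hP _, fun u v huv => by
    rw [← f.map_adj_iff, hadj _ _ (f.injective.ne huv)]; rfl⟩

/-! ### Neighbours as intervals on a path -/

namespace GeodesicModel

variable {V : Type*} {G : SimpleGraph V} (M : GeodesicModel G)

/-- A coordinate on the path of `v`, and the interval in which the path of `v` meets the path
of `u`, for `u = v` and for the neighbours `u` of `v`. -/
structure Chart (v : V) where
  pos : ℤ × ℤ → ℤ
  lo : V → ℤ
  hi : V → ℤ
  gdist_eq : ∀ {r s}, r ∈ M.pts v → s ∈ M.pts v → gdist r s = (pos r - pos s).natAbs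
  mem_iff : ∀ {u}, u = v ∨ G.Adj v u → ∀ {r}, r ∈ M.pts v →
    (r ∈ M.pts u ↔ lo u ≤ pos r ∧ pos r ≤ hi u)
  exists_point : ∀ {u}, u = v ∨ G.Adj v u → ∀ {k}, lo u ≤ k → k ≤ hi u →
    ∃ r ∈ M.pts v, r ∈ M.pts u ∧ pos r = k
  le : ∀ {u}, u = v ∨ G.Adj v u → lo u ≤ hi u
  self_le : ∀ {u}, G.Adj v u → lo v ≤ lo u ∧ hi u ≤ hi v

/-- By convexity, the points in common with a neighbour are exactly those between the two extreme
ones. -/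
theorem exists_chart_of_pos (v : V) (pos : ℤ × ℤ → ℤ)
    (hd : ∀ r ∈ M.pts v, ∀ s ∈ M.pts v, gdist r s = (pos r - pos s).natAbs)
    (hk : ∀ r ∈ M.pts v, ∀ t ∈ M.pts v, ∀ k, pos r ≤ k → k ≤ pos t → ∃ s ∈ M.pts v, pos s = k)
    (B : ℤ) (hB : ∀ r ∈ M.pts v, -B ≤ pos r ∧ pos r ≤ B) :
    ∃ c : M.Chart v, c.pos = pos := by
  have H : ∀ u, ∃ a b : ℤ, (u = v ∨ G.Adj v u) →
      (∃ r ∈ M.pts v, r ∈ M.pts u ∧ pos r = a) ∧ (∃ r ∈ M.pts v, r ∈ M.pts u ∧ pos r = b) ∧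
      ∀ r ∈ M.pts v, r ∈ M.pts u → a ≤ pos r ∧ pos r ≤ b := by
    intro u
    by_cases hu : u = v ∨ G.Adj v u
    · have hne : ∃ r ∈ M.pts v, r ∈ M.pts u := by
        rcases hu with rfl | hu
        · obtain ⟨r, hr⟩ := M.nonempty u
          exact ⟨r, hr, hr⟩
        · obtain ⟨r, s, h1, h2, -⟩ := (M.adj_iff hu.ne).1 hu
          exact ⟨r, h1, h2⟩
      obtain ⟨r0, h0, h0'⟩ := hne
      obtain ⟨a, ⟨ra, ha⟩, ha'⟩ := Int.exists_least_of_bdd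
        (P := fun k => ∃ r ∈ M.pts v, r ∈ M.pts u ∧ pos r = k)
        ⟨-B, by rintro _ ⟨r, hr, -, rfl⟩; exact (hB r hr).1⟩ ⟨_, r0, h0, h0', rfl⟩
      obtain ⟨b, ⟨rb, hb⟩, hb'⟩ := Int.exists_greatest_of_bdd
        (P := fun k => ∃ r ∈ M.pts v, r ∈ M.pts u ∧ pos r = k)
        ⟨B, by rintro _ ⟨r, hr, -, rfl⟩; exact (hB r hr).2⟩ ⟨_, r0, h0, h0', rfl⟩
      exact ⟨a, b, fun _ => ⟨⟨ra, ha⟩, ⟨rb, hb⟩,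
        fun r hr hr' => ⟨ha' _ ⟨r, hr, hr', rfl⟩, hb' _ ⟨r, hr, hr', rfl⟩⟩⟩⟩
    -- Junk values: charts say nothing about vertices that are neither `v` nor adjacent to it.
    · exact ⟨0, 0, fun h => absurd h hu⟩
  choose lo hi H using H
  have mem : ∀ {u}, u = v ∨ G.Adj v u → ∀ {r}, r ∈ M.pts v →
      (r ∈ M.pts u ↔ lo u ≤ pos r ∧ pos r ≤ hi u) := by
    intro u hu r hr
    obtain ⟨⟨a, ha, ha', ea⟩, ⟨b, hb, hb', eb⟩, h⟩ := H u hu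
    refine ⟨h r hr, fun h => ?_⟩
    rcases hu with rfl | hu
    · exact hr
    · refine M.convex hu ha ha' hb hb' hr ?_
      rw [hd _ ha _ hr, hd _ hr _ hb, hd _ ha _ hb]
      omega
  refine ⟨⟨pos, lo, hi, fun hr hs => hd _ hr _ hs, mem, ?_, ?_, ?_⟩, rfl⟩
  · intro u hu k hk1 hk2
    obtain ⟨⟨a, ha, ha', ea⟩, ⟨b, hb, hb', eb⟩, h⟩ := H u hu
    obtain ⟨s, hs, rfl⟩ := hk a ha b hb k (by omega) (by omega)
    exact ⟨s, hs, (mem hu hs).2 (by omega), rfl⟩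
  · intro u hu
    obtain ⟨⟨a, ha, ha', ea⟩, -, h⟩ := H u hu
    have := h a ha ha'
    omega
  · intro u hu
    obtain ⟨⟨a, ha, ha', ea⟩, ⟨b, hb, hb', eb⟩, h⟩ := H u (Or.inr hu)
    obtain ⟨-, -, h⟩ := H v (Or.inl rfl)
    have := h a ha ha
    have := h b hb hb
    omega

theorem exists_chart (v : V) : Nonempty (M.Chart v) := by
  obtain ⟨pos, hd, hk, B, hB⟩ := M.exists_pos v
  obtain ⟨c, -⟩ := M.exists_chart_of_pos v pos hd hk B hB
  exact ⟨c⟩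

theorem exists_oriented_chart {v : V} {p p' : ℤ × ℤ} (hp : p ∈ M.pts v) (hp' : p' ∈ M.pts v)
    (h : gdist p p' = 1) : ∃ c : M.Chart v, c.pos p = 0 ∧ c.pos p' = 1 := by
  obtain ⟨pos, hd, hk, B, hB⟩ := M.exists_pos v
  have hpp := hd p hp p' hp'
  have hBp := hB p hp
  rw [h] at hpp
  rcases (show pos p' - pos p = 1 ∨ pos p' - pos p = -1 by omega) with h | h
  · obtain ⟨c, hc⟩ := M.exists_chart_of_pos v (fun r => pos r - pos p)
      (fun r hr s hs => by rw [hd r hr s hs]; omega)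
      (fun r hr t ht k h1 h2 => by
        obtain ⟨s, hs, e⟩ := hk r hr t ht (k + pos p) (by omega) (by omega)
        exact ⟨s, hs, by omega⟩)
      -- The translation moves `p` to the origin, by at most `B`.
      (2 * B) (fun r hr => by have := hB r hr; omega)
    exact ⟨c, by rw [hc]; beta_reduce; omega, by rw [hc]; beta_reduce; omega⟩
  · obtain ⟨c, hc⟩ := M.exists_chart_of_pos v (fun r => pos p - pos r)
      (fun r hr s hs => by rw [hd r hr s hs]; omega)
      (fun r hr t ht k h1 h2 => by
        obtain ⟨s, hs, e⟩ := hk t ht r hr (pos p - k) (by omega) (by omega)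
        exact ⟨s, hs, by omega⟩)
      (2 * B) (fun r hr => by have := hB r hr; omega)
    exact ⟨c, by rw [hc]; beta_reduce; omega, by rw [hc]; beta_reduce; omega⟩

variable {M}

theorem adj_of_mem {u v : V} (huv : u ≠ v) {r s : ℤ × ℤ} (h1 : r ∈ M.pts u) (h2 : r ∈ M.pts v)
    (h3 : s ∈ M.pts u) (h4 : s ∈ M.pts v) (h : gdist r s = 1) : G.Adj u v :=
  (M.adj_iff huv).2 ⟨r, s, h1, h2, h3, h4, h⟩

namespace Chart

variable {v : V} (c : M.Chart v)
include c

theorem lt {u : V} (hu : G.Adj v u) : c.lo u < c.hi u := by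
  obtain ⟨r, s, h1, h2, h3, h4, h⟩ := (M.adj_iff hu.ne).1 hu
  have := (c.mem_iff (Or.inr hu) h1).1 h2
  have := (c.mem_iff (Or.inr hu) h3).1 h4
  have := c.gdist_eq h1 h3
  omega

theorem mem {u : V} (hu : G.Adj v u) {r : ℤ × ℤ} (h : r ∈ M.pts v) (h' : r ∈ M.pts u) :
    c.lo u ≤ c.pos r ∧ c.pos r ≤ c.hi u :=
  (c.mem_iff (Or.inr hu) h).1 h'

theorem touch {u w : V} (hu : G.Adj v u) (hw : G.Adj v w) (huw : G.Adj u w) :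
    c.lo u ≤ c.hi w ∧ c.lo w ≤ c.hi u := by
  obtain ⟨r, h1, h2, h3⟩ := M.helly hu huw hw
  have := c.mem hu h1 h2
  have := c.mem hw h1 h3
  omega

/-- Intervals meeting in more than a point would contain two common points at distance one. -/
theorem disjoint {u w : V} (hu : G.Adj v u) (hw : G.Adj v w) (hne : u ≠ w) (huw : ¬ G.Adj u w) :
    c.hi u ≤ c.lo w ∨ c.hi w ≤ c.lo u := by
  by_contra! h
  have hlu := c.lt hu
  have hlw := c.lt hw
  obtain ⟨r, h1, h2, h3⟩ := c.exists_point (Or.inr hu) (k := max (c.lo u) (c.lo w))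
    (by omega) (by omega)
  obtain ⟨s, h4, h5, h6⟩ := c.exists_point (Or.inr hu) (k := max (c.lo u) (c.lo w) + 1)
    (by omega) (by omega)
  refine huw (adj_of_mem hne h2 ((c.mem_iff (Or.inr hw) h1).2 (by omega)) h5
    ((c.mem_iff (Or.inr hw) h4).2 (by omega)) ?_)
  rw [c.gdist_eq h1 h4]
  omega

/-- The vertices `u` and `w` lie on the same side of `b`. -/
def SameSide (b u w : V) : Prop :=
  (c.hi u ≤ c.lo b ∧ c.hi w ≤ c.lo b) ∨ (c.hi b ≤ c.lo u ∧ c.hi b ≤ c.lo w)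

theorem sameSide_of_adj {b u w : V} (hb : G.Adj v b) (hu : G.Adj v u) (hw : G.Adj v w)
    (huw : G.Adj u w) (hub : u ≠ b ∧ ¬ G.Adj u b) (hwb : w ≠ b ∧ ¬ G.Adj w b) :
    c.SameSide b u w := by
  have h1 := c.disjoint hu hb hub.1 hub.2
  have h2 := c.disjoint hw hb hwb.1 hwb.2
  have h3 := c.touch hu hw huw
  have h4 := c.lt hb
  unfold SameSide
  omega

theorem SameSide.trans {b u w x : V} (hb : G.Adj v b) (hw : G.Adj v w) (h : c.SameSide b u w)
    (h' : c.SameSide b w x) : c.SameSide b u x := by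
  have := c.lt hb
  have := c.lt hw
  unfold SameSide at *
  omega

theorem sameSide_of_isChain {b : V} (hb : G.Adj v b) (u : V) (l : List V)
    (hl : List.IsChain G.Adj (u :: l)) (h : ∀ w ∈ u :: l, G.Adj v w ∧ w ≠ b ∧ ¬ G.Adj w b) :
    c.SameSide b u ((u :: l).getLast (List.cons_ne_nil u l)) := by
  induction l generalizing u with
  | nil =>
    obtain ⟨h1, h2, h3⟩ := h u (by simp)
    have := c.disjoint h1 hb h2 h3
    unfold SameSide
    simp only [List.getLast_singleton]
    omega
  | cons w l ih =>
    rw [List.isChain_cons_cons] at hl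
    have hu := h u (by simp)
    have hw := h w (by simp)
    have := ih w hl.2 (fun x hx => h x (List.mem_cons_of_mem _ hx))
    exact (c.sameSide_of_adj hb hu.1 hw.1 hl.1 hu.2 hw.2).trans c hb hw.1 this

theorem sameSide_of_seq {b : V} (hb : G.Adj v b) (t : ℕ → V) (n : ℕ)
    (hadj : ∀ i < n, G.Adj (t i) (t (i + 1)))
    (h : ∀ i ≤ n, G.Adj v (t i) ∧ t i ≠ b ∧ ¬ G.Adj (t i) b) : c.SameSide b (t 0) (t n) := by
  induction n with
  | zero =>
    obtain ⟨h1, h2, h3⟩ := h 0 le_rfl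
    have := c.disjoint h1 hb h2 h3
    unfold SameSide
    omega
  | succ n ih =>
    have h1 := h n (by omega)
    have h2 := h (n + 1) le_rfl
    exact (ih (fun i hi => hadj i (by omega)) (fun i hi => h i (by omega))).trans c hb h1.1
      (c.sameSide_of_adj hb h1.1 h2.1 (hadj n (by omega)) h1.2 h2.2)

/-- The neighbourhood of a vertex has no asteroidal triple. -/
theorem false_of_sameSide {x y z : V} (hx : G.Adj v x) (hy : G.Adj v y) (hz : G.Adj v z)
    (h1 : c.SameSide x y z) (h2 : c.SameSide y x z) (h3 : c.SameSide z x y) : False := by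
  have := c.lt hx
  have := c.lt hy
  have := c.lt hz
  unfold SameSide at *
  omega

/-- `x` lies between `y` and `z`. -/
def Middle (x y z : V) : Prop :=
  (c.hi y ≤ c.lo x ∧ c.hi x ≤ c.lo z) ∨ (c.hi z ≤ c.lo x ∧ c.hi x ≤ c.lo y)

/-- The interval of `u` touches those of `y` and `z`, hence covers that of `x` between them. The
interval of `w` touches that of `x` but can only begin where `u` ends, which must then be where `y`
or `z` begins, so it overlaps `y` or `z`. -/
theorem not_middle {u w x y z : V} (hu : G.Adj v u) (hx : G.Adj v x)
    (hy : G.Adj v y) (hz : G.Adj v z) (hw : G.Adj v w) (huy : G.Adj u y)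
    (huz : G.Adj u z) (hwx : G.Adj w x) (hwu : w ≠ u ∧ ¬ G.Adj w u) (hwy : w ≠ y ∧ ¬ G.Adj w y)
    (hwz : w ≠ z ∧ ¬ G.Adj w z) : ¬ c.Middle x y z := by
  have h1 := c.touch hu hy huy
  have h2 := c.touch hu hz huz
  have h3 := c.touch hw hx hwx
  have h4 := c.disjoint hw hu hwu.1 hwu.2
  have h5 := c.disjoint hw hy hwy.1 hwy.2
  have h6 := c.disjoint hw hz hwz.1 hwz.2
  have := c.lt hu
  have := c.lt hw
  have := c.lt hx
  have := c.lt hy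
  have := c.lt hz
  unfold Middle
  omega

theorem middle_or {x y z : V} (hx : G.Adj v x) (hy : G.Adj v y) (hz : G.Adj v z)
    (hxy : x ≠ y ∧ ¬ G.Adj x y) (hyz : y ≠ z ∧ ¬ G.Adj y z) (hxz : x ≠ z ∧ ¬ G.Adj x z) :
    c.Middle x y z ∨ c.Middle y x z ∨ c.Middle z x y := by
  have h4 := c.disjoint hx hy hxy.1 hxy.2
  have h5 := c.disjoint hy hz hyz.1 hyz.2
  have h6 := c.disjoint hx hz hxz.1 hxz.2
  have := c.lt hx
  have := c.lt hy
  have := c.lt hz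
  unfold Middle
  omega

/-- By Helly, `u` and `v` have a common point `r` on `y` and another, `s`, on `z`. Between them on
`v` lie the extreme points `a`, `b` of `x`, which are therefore also on `u`. The mutual distances do
not depend on the path, so `a` and `b` are between `r` and `s` on `u` too. -/
theorem middle_of_middle {u x y z : V} (d : M.Chart u) (huv : G.Adj v u)
    (hx : G.Adj v x) (hy : G.Adj v y) (hz : G.Adj v z)
    (hx' : G.Adj u x) (hy' : G.Adj u y) (hz' : G.Adj u z)
    (hxy : x ≠ y ∧ ¬ G.Adj x y) (hxz : x ≠ z ∧ ¬ G.Adj x z)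
    (h : c.Middle x y z) : d.Middle x y z := by
  have lx := c.lt hx
  have ly := c.lt hy
  have lz := c.lt hz
  obtain ⟨r, r1, r2, r3⟩ := M.helly huv hy' hy
  obtain ⟨s, s1, s2, s3⟩ := M.helly huv hz' hz
  obtain ⟨a, a1, a2, ea⟩ := c.exists_point (Or.inr hx) le_rfl lx.le
  obtain ⟨b, b1, b2, eb⟩ := c.exists_point (Or.inr hx) lx.le le_rfl
  have hr := c.mem hy r1 r3
  have hs := c.mem hz s1 s3
  have mr := c.mem huv r1 r2
  have ms := c.mem huv s1 s2
  have a3 : a ∈ M.pts u := (c.mem_iff (Or.inr huv) a1).2 (by unfold Middle at h; omega)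
  have b3 : b ∈ M.pts u := (c.mem_iff (Or.inr huv) b1).2 (by unfold Middle at h; omega)
  have ma := d.mem hx' a3 a2
  have mb := d.mem hx' b3 b2
  have mr' := d.mem hy' r2 r3
  have ms' := d.mem hz' s2 s3
  have e1 := c.gdist_eq r1 a1
  have e2 := c.gdist_eq r1 b1
  have e3 := c.gdist_eq r1 s1
  have e4 := c.gdist_eq a1 b1
  have e5 := c.gdist_eq a1 s1
  have e6 := c.gdist_eq b1 s1
  rw [d.gdist_eq r2 a3] at e1
  rw [d.gdist_eq r2 b3] at e2
  rw [d.gdist_eq r2 s2] at e3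
  rw [d.gdist_eq a3 b3] at e4
  rw [d.gdist_eq a3 s2] at e5
  rw [d.gdist_eq b3 s2] at e6
  have d1 := d.disjoint hx' hy' hxy.1 hxy.2
  have d2 := d.disjoint hx' hz' hxz.1 hxz.2
  have k0 : (c.pos r ≤ c.pos a ∧ c.pos a < c.pos b ∧ c.pos b ≤ c.pos s) ∨
      (c.pos s ≤ c.pos a ∧ c.pos a < c.pos b ∧ c.pos b ≤ c.pos r) := by
    clear e1 e2 e3 e4 e5 e6
    unfold Middle at h
    omega
  have k1 : (d.pos r ≤ d.pos a ∧ d.pos a < d.pos b ∧ d.pos b ≤ d.pos s) ∨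
      (d.pos s ≤ d.pos b ∧ d.pos b < d.pos a ∧ d.pos a ≤ d.pos r) ∨
      (d.pos r ≤ d.pos b ∧ d.pos b < d.pos a ∧ d.pos a ≤ d.pos s) ∨
      (d.pos s ≤ d.pos a ∧ d.pos a < d.pos b ∧ d.pos b ≤ d.pos r) := by
    clear lx ly lz hr hs mr ms ma mb mr' ms' d1 d2 ea eb h e3
    omega
  clear e1 e2 e3 e4 e5 e6 k0
  unfold Middle
  omega

/-- Let `o`, `x`, `y`, `a` be neighbours of `v`, and `u`, `o`, `x`, `y` pairwise adjacent or not as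
in the graph `F10`. Seen from a common point of `o`, `u` and `v`, the vertex `y` is nearer than
`x`. -/
theorem exists_nearer {u o x y a : V} (hu : G.Adj v u) (ho : G.Adj v o) (hx : G.Adj v x)
    (hy : G.Adj v y) (ha : G.Adj v a) (huo : G.Adj u o) (hux : G.Adj u x) (huy : G.Adj u y)
    (hxa : G.Adj x a) (hua : u ≠ a ∧ ¬ G.Adj u a) (hox : o ≠ x ∧ ¬ G.Adj o x)
    (hoy : o ≠ y ∧ ¬ G.Adj o y) (hoa : o ≠ a ∧ ¬ G.Adj o a) (hxy : x ≠ y ∧ ¬ G.Adj x y)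
    (hya : y ≠ a ∧ ¬ G.Adj y a) (hside : c.SameSide o x y) {r : ℤ × ℤ} (rv : r ∈ M.pts v)
    (ro : r ∈ M.pts o) (ru : r ∈ M.pts u) :
    ∃ s t, s ∈ M.pts y ∧ t ∈ M.pts y ∧ s ∈ M.pts v ∧ t ∈ M.pts v ∧ s ∈ M.pts u ∧ t ∈ M.pts u ∧
      gdist r s < gdist r t ∧
      ∀ w, w ∈ M.pts v → w ∈ M.pts x → gdist r t ≤ gdist r w := by
  have h1 := c.touch hu ho huo
  have h2 := c.touch hu hx hux
  have h3 := c.touch hu hy huy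
  have h4 := c.touch hx ha hxa
  have h5 := c.disjoint hu ha hua.1 hua.2
  have h6 := c.disjoint ho hx hox.1 hox.2
  have h7 := c.disjoint ho hy hoy.1 hoy.2
  have h8 := c.disjoint ho ha hoa.1 hoa.2
  have h9 := c.disjoint hx hy hxy.1 hxy.2
  have h10 := c.disjoint hy ha hya.1 hya.2
  have l1 := c.lt hu
  have l2 := c.lt ho
  have l3 := c.lt hx
  have l4 := c.lt hy
  have l5 := c.lt ha
  have mo := c.mem ho rv ro
  have mu := c.mem hu rv ru
  -- If `x` were between `o` and `y`, then `u` would cover it, leaving no room for `a`, as in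
  -- `not_middle`. Hence `y` is between `o` and `x`, and `u`, which reaches from `o` to `x`,
  -- contains the whole trace of `y` on `v`.
  have key : (c.hi o ≤ c.lo y ∧ c.hi y ≤ c.lo x ∧ c.lo x ≤ c.hi u) ∨
      (c.hi x ≤ c.lo y ∧ c.hi y ≤ c.lo o ∧ c.lo u ≤ c.hi x) := by
    unfold SameSide at hside; omega
  clear h1 h2 h3 h4 h5 h6 h7 h8 h9 h10 hside
  rcases key with key | key
  · obtain ⟨s, sv, sy, es⟩ := c.exists_point (Or.inr hy) le_rfl l4.le
    obtain ⟨t, tv, ty, et⟩ := c.exists_point (Or.inr hy) l4.le le_rfl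
    refine ⟨s, t, sy, ty, sv, tv, (c.mem_iff (Or.inr hu) sv).2 (by omega),
      (c.mem_iff (Or.inr hu) tv).2 (by omega), ?_, fun w wv wx => ?_⟩
    · rw [c.gdist_eq rv sv, c.gdist_eq rv tv]; omega
    · have := c.mem hx wv wx
      rw [c.gdist_eq rv wv, c.gdist_eq rv tv]; omega
  · obtain ⟨t, tv, ty, et⟩ := c.exists_point (Or.inr hy) le_rfl l4.le
    obtain ⟨s, sv, sy, es⟩ := c.exists_point (Or.inr hy) l4.le le_rfl
    refine ⟨s, t, sy, ty, sv, tv, (c.mem_iff (Or.inr hu) sv).2 (by omega),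
      (c.mem_iff (Or.inr hu) tv).2 (by omega), ?_, fun w wv wx => ?_⟩
    · rw [c.gdist_eq rv sv, c.gdist_eq rv tv]; omega
    · have := c.mem hx wv wx
      rw [c.gdist_eq rv wv, c.gdist_eq rv tv]; omega

end Chart

end GeodesicModel

/-! ### Common points and common edges of cliques -/

namespace GeodesicModel

variable {V : Type*} {G : SimpleGraph V} {M : GeodesicModel G}

/-- On the path of one member the others cut out pairwise touching intervals, and the largest left
end lies in all of them. -/
theorem exists_mem_of_clique (M : GeodesicModel G) {Q : Set V} (hQ : G.IsClique Q) :
    ∃ p, ∀ q ∈ Q, p ∈ M.pts q := by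
  rcases Q.eq_empty_or_nonempty with rfl | ⟨v, hv⟩
  · exact ⟨(0, 0), by simp⟩
  have hadj : ∀ u ∈ Q, u = v ∨ G.Adj v u := by
    intro u hu
    by_cases h : u = v
    · exact Or.inl h
    · exact Or.inr (hQ hv hu (Ne.symm h))
  obtain ⟨c⟩ := M.exists_chart v
  have self : ∀ u ∈ Q, c.lo v ≤ c.lo u ∧ c.hi u ≤ c.hi v := by
    intro u hu
    rcases hadj u hu with rfl | h
    · exact ⟨le_rfl, le_rfl⟩
    · exact c.self_le h
  obtain ⟨k, ⟨u, hu, rfl⟩, hk⟩ := Int.exists_greatest_of_bdd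
    (P := fun k => ∃ u ∈ Q, c.lo u = k)
    ⟨c.hi v, by
      rintro _ ⟨u, hu, rfl⟩
      exact (c.le (hadj u hu)).trans (self u hu).2⟩ ⟨_, v, hv, rfl⟩
  obtain ⟨p, pv, pu, e⟩ := c.exists_point (hadj u hu) le_rfl (c.le (hadj u hu))
  refine ⟨p, fun w hw => (c.mem_iff (hadj w hw) pv).2 ⟨e ▸ hk _ ⟨w, hw, rfl⟩, e ▸ ?_⟩⟩
  have h1 := self u hu
  have h2 := self w hw
  have h3 := c.le (hadj u hu)
  have h4 := c.le (hadj w hw)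
  by_cases huw : u = w
  · exact huw ▸ h3
  rcases hadj u hu with rfl | hu'
  · omega
  rcases hadj w hw with rfl | hw'
  · omega
  exact (c.touch hu' hw' (hQ hu hw huw)).1

/-- On the path of any member, the traces of the others are intervals containing `p` and `r`, hence
the step from `p` towards `r`. -/
theorem exists_next_mem_of_clique {K : Set V} (hK : G.IsClique K) (hne : K.Nonempty)
    {p r : ℤ × ℤ} (hp : ∀ q ∈ K, p ∈ M.pts q) (hr : ∀ q ∈ K, r ∈ M.pts q) (hpr : p ≠ r) :
    ∃ p', gdist p p' = 1 ∧ ∀ q ∈ K, p' ∈ M.pts q := by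
  obtain ⟨v, hv⟩ := hne
  have hadj : ∀ u ∈ K, u = v ∨ G.Adj v u := by
    intro u hu
    by_cases h : u = v
    · exact Or.inl h
    · exact Or.inr (hK hv hu (Ne.symm h))
  obtain ⟨c⟩ := M.exists_chart v
  have hd := c.gdist_eq (hp v hv) (hr v hv)
  have hpos : c.pos p ≠ c.pos r := by
    intro h
    rw [h] at hd
    exact hpr (eq_of_gdist_eq_zero (by simpa using hd))
  have mp := (c.mem_iff (Or.inl rfl) (hp v hv)).1 (hp v hv)
  have mr := (c.mem_iff (Or.inl rfl) (hr v hv)).1 (hr v hv)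
  obtain ⟨p', p'v, -, e⟩ := c.exists_point (Or.inl rfl)
    (k := if c.pos p < c.pos r then c.pos p + 1 else c.pos p - 1)
    (by split_ifs <;> omega) (by split_ifs <;> omega)
  refine ⟨p', ?_, fun q hq => (c.mem_iff (hadj q hq) p'v).2 ?_⟩
  · rw [c.gdist_eq (hp v hv) p'v, e]
    split_ifs <;> omega
  · have := (c.mem_iff (hadj q hq) (hp v hv)).1 (hp q hq)
    have := (c.mem_iff (hadj q hq) (hr v hv)).1 (hr q hq)
    rw [e]
    split_ifs <;> omega

theorem exists_next_mem_of_adj {u v : V} (huv : G.Adj u v) {p : ℤ × ℤ} (hu : p ∈ M.pts u)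
    (hv : p ∈ M.pts v) : ∃ p', gdist p p' = 1 ∧ p' ∈ M.pts u ∧ p' ∈ M.pts v := by
  obtain ⟨r, s, ru, rv, su, sv, h⟩ := (M.adj_iff huv.ne).1 huv
  have : ∃ t, t ∈ M.pts u ∧ t ∈ M.pts v ∧ p ≠ t := by
    by_cases hpr : p = r
    · refine ⟨s, su, sv, ?_⟩
      rintro rfl
      subst hpr
      simp [gdist] at h
    · exact ⟨r, ru, rv, hpr⟩
  obtain ⟨t, tu, tv, hpt⟩ := this
  obtain ⟨p', h, h'⟩ := M.exists_next_mem_of_clique (K := {u, v}) (p := p) (r := t)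
    (by simpa [Set.pairwise_insert, IsClique, huv.symm] using fun _ => huv) (by simp)
    (by simp [hu, hv]) (by simp [tu, tv]) hpt
  exact ⟨p', h, h' u (by simp), h' v (by simp)⟩

/-- A path has at most two points next to a given one. -/
theorem eq_or_eq_or_eq_of_mem {v : V} {p r s t : ℤ × ℤ} (hp : p ∈ M.pts v) (hr : r ∈ M.pts v)
    (hs : s ∈ M.pts v) (ht : t ∈ M.pts v) (pr : gdist p r = 1) (ps : gdist p s = 1)
    (pt : gdist p t = 1) : r = s ∨ r = t ∨ s = t := by
  obtain ⟨pos, hd, -⟩ := M.exists_pos v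
  rw [hd p hp r hr] at pr
  rw [hd p hp s hs] at ps
  rw [hd p hp t ht] at pt
  have h : pos r = pos s ∨ pos r = pos t ∨ pos s = pos t := by omega
  refine h.imp (fun h => ?_) (Or.imp (fun h => ?_) (fun h => ?_)) <;>
    refine eq_of_gdist_eq_zero ?_
  · rw [hd r hr s hs, h]; simp
  · rw [hd r hr t ht, h]; simp
  · rw [hd s hs t ht, h]; simp

/-- A clique with two nonadjacent common neighbours has a common grid edge. -/
theorem exists_common_edge (M : GeodesicModel G) {K : Set V} (hK : G.IsClique K)
    (hne : K.Nonempty) {z w : V}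
    (hzw : z ≠ w) (hzw' : ¬ G.Adj z w) (hz : ∀ q ∈ K, G.Adj q z) (hw : ∀ q ∈ K, G.Adj q w) :
    ∃ p p', gdist p p' = 1 ∧ ∀ q ∈ K, p ∈ M.pts q ∧ p' ∈ M.pts q := by
  obtain ⟨p, hp⟩ := M.exists_mem_of_clique (hK.insert (a := z) fun q hq _ => (hz q hq).symm)
  obtain ⟨r, hr⟩ := M.exists_mem_of_clique (hK.insert (a := w) fun q hq _ => (hw q hq).symm)
  have hpK : ∀ q ∈ K, p ∈ M.pts q := fun q hq => hp q (Set.mem_insert_of_mem _ hq)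
  have hrK : ∀ q ∈ K, r ∈ M.pts q := fun q hq => hr q (Set.mem_insert_of_mem _ hq)
  have pz : p ∈ M.pts z := hp z (Set.mem_insert _ _)
  have rw' : r ∈ M.pts w := hr w (Set.mem_insert _ _)
  by_cases hpr : p = r
  swap
  · obtain ⟨p', h, h'⟩ := M.exists_next_mem_of_clique hK hne hpK hrK hpr
    exact ⟨p, p', h, fun q hq => ⟨hpK q hq, h' q hq⟩⟩
  subst hpr
  have far : ∀ {s t}, gdist p s = 1 → s ∈ M.pts z → t ∈ M.pts w → s ≠ t := by
    rintro s _ h hs ht rfl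
    exact hzw' (adj_of_mem hzw pz rw' hs ht h)
  -- Everything now passes through `p`, and no grid edge at `p` lies on both `z` and `w`. A path has
  -- at most two edges at `p`, so without a common edge three members would use three edges at `p`
  -- in pairs, as in a claw. Since `q₁` has one edge with `z` and the other with `w`, the third edge
  -- is forced to be shared by `q₂` with `z` and by `q₃` with `w`.
  by_contra! hcon
  obtain ⟨q₁, k₁⟩ := hne
  obtain ⟨s, ps, s1, sz⟩ := exists_next_mem_of_adj (hz q₁ k₁) (hpK _ k₁) pz
  obtain ⟨t, pt, t1, tw⟩ := exists_next_mem_of_adj (hw q₁ k₁) (hpK _ k₁) rw'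
  obtain ⟨q₂, k₂, h₂⟩ := hcon p s ps
  obtain ⟨q₃, k₃, h₃⟩ := hcon p t pt
  have s2 := h₂ (hpK _ k₂)
  have t3 := h₃ (hpK _ k₃)
  have hst : s ≠ t := far ps sz tw
  have share : ∀ q ∈ K, q ≠ q₁ → s ∈ M.pts q ∨ t ∈ M.pts q := by
    intro q hq hne
    obtain ⟨m, pm, mq, m1⟩ := exists_next_mem_of_adj (hK hq k₁ hne) (hpK _ hq) (hpK _ k₁)
    rcases eq_or_eq_or_eq_of_mem (hpK _ k₁) s1 t1 m1 ps pt pm with h | h | h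
    · exact absurd h hst
    · exact Or.inl (h ▸ mq)
    · exact Or.inr (h ▸ mq)
  have t2 : t ∈ M.pts q₂ := (share q₂ k₂ (by rintro rfl; exact s2 s1)).resolve_left s2
  have s3 : s ∈ M.pts q₃ := (share q₃ k₃ (by rintro rfl; exact t3 t1)).resolve_right t3
  obtain ⟨s', ps', s2', sz'⟩ := exists_next_mem_of_adj (hz q₂ k₂) (hpK _ k₂) pz
  obtain ⟨t', pt', t3', tw'⟩ := exists_next_mem_of_adj (hw q₃ k₃) (hpK _ k₃) rw'
  obtain ⟨m, pm, m2, m3⟩ := exists_next_mem_of_adj (hK k₂ k₃ (by rintro rfl; exact s2 s3))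
    (hpK _ k₂) (hpK _ k₃)
  have hms' : m = s' := by
    rcases eq_or_eq_or_eq_of_mem (hpK _ k₂) t2 s2' m2 pt ps' pm with h | h | h
    · exact absurd h.symm (far ps' sz' tw)
    · exact absurd (h ▸ m3) t3
    · exact h.symm
  subst hms'
  rcases eq_or_eq_or_eq_of_mem (hpK _ k₃) s3 t3' m3 ps pt' pm with h | h | h
  · exact far ps sz tw' h
  · exact s2 (h ▸ m2)
  · exact far pm sz' tw' h.symm

/-- If a subset `K` of the clique `Q` has a common grid edge, then it has a common grid edge at a
common point of `Q`. -/
theorem exists_common_edge_at (M : GeodesicModel G) {K Q : Set V} (hQ : G.IsClique Q)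
    (hKQ : K ⊆ Q) (hne : K.Nonempty) {z w : V}
    (hzw : z ≠ w) (hzw' : ¬ G.Adj z w) (hz : ∀ q ∈ K, G.Adj q z) (hw : ∀ q ∈ K, G.Adj q w) :
    ∃ p p', gdist p p' = 1 ∧ (∀ q ∈ Q, p ∈ M.pts q) ∧ ∀ q ∈ K, p' ∈ M.pts q := by
  have hK := hQ.subset hKQ
  obtain ⟨r, s, hrs, h⟩ := M.exists_common_edge hK hne hzw hzw' hz hw
  obtain ⟨p, hp⟩ := M.exists_mem_of_clique hQ
  -- The common edge of `K` may be away from `p`; one of its ends differs from `p`, and the step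
  -- towards that end is common to `K`.
  have : ∃ t, (∀ q ∈ K, t ∈ M.pts q) ∧ p ≠ t := by
    by_cases hpr : p = r
    · refine ⟨s, fun q hq => (h q hq).2, ?_⟩
      rintro rfl
      subst hpr
      simp [gdist] at hrs
    · exact ⟨r, fun q hq => (h q hq).1, hpr⟩
  obtain ⟨t, ht, hpt⟩ := this
  obtain ⟨p', h, h'⟩ := M.exists_next_mem_of_clique hK hne (fun q hq => hp q (hKQ hq)) ht hpt
  exact ⟨p, p', h, hp, h'⟩

/-! ### The two sides of a grid edge -/

variable (M) in
/-- The path of `v` contains the points `p` and `p'`. -/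
def Has (p p' : ℤ × ℤ) (v : V) : Prop := p ∈ M.pts v ∧ p' ∈ M.pts v

variable (M) in
/-- `x` meets a path containing the edge from `p` to `p'` in a point on the side of `p'`. -/
def Beyond (p p' : ℤ × ℤ) (x : V) : Prop :=
  ∃ q, M.Has p p' q ∧ G.Adj q x ∧ ∃ r, r ∈ M.pts x ∧ r ∈ M.pts q ∧ gdist r p' < gdist r p

section Side

variable {p p' : ℤ × ℤ} (hpp : gdist p p' = 1)
include hpp

theorem not_has {q x : V} (hq : M.Has p p' q) (hne : q ≠ x) (hqx : ¬ G.Adj q x) :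
    ¬ M.Has p p' x :=
  fun h => hqx (adj_of_mem hne hq.1 h.1 hq.2 h.2 hpp)

/-- The position of `x` on a path `q` containing the edge from `p` to `p'`. -/
theorem Chart.side {q x : V} (c : M.Chart q) (c0 : c.pos p = 0) (c1 : c.pos p' = 1)
    (hq : M.Has p p' q) (hqx : G.Adj q x) (hx : ¬ M.Has p p' x) :
    (M.Beyond p p' x ∧ 1 ≤ c.lo x) ∨ (¬ M.Beyond p p' x ∧ c.hi x ≤ 0) := by
  have split : ∀ {q} (c : M.Chart q), c.pos p = 0 → c.pos p' = 1 → M.Has p p' q → G.Adj q x →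
      1 ≤ c.lo x ∨ c.hi x ≤ 0 := by
    intro q c c0 c1 hq hqx
    by_contra! h
    exact hx ⟨(c.mem_iff (Or.inr hqx) hq.1).2 (by omega),
      (c.mem_iff (Or.inr hqx) hq.2).2 (by omega)⟩
  have right : ∀ {q} (c : M.Chart q), c.pos p = 0 → c.pos p' = 1 → M.Has p p' q →
      ∀ {r}, r ∈ M.pts q → (gdist r p' < gdist r p ↔ 1 ≤ c.pos r) := by
    intro q c c0 c1 hq r hr
    rw [c.gdist_eq hr hq.1, c.gdist_eq hr hq.2, c0, c1]
    omega
  by_cases h : 1 ≤ c.lo x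
  · obtain ⟨r, rq, rx, e⟩ := c.exists_point (Or.inr hqx) le_rfl (c.lt hqx).le
    exact Or.inl ⟨⟨q, hq, hqx, r, rx, rq, (right c c0 c1 hq rq).2 (by omega)⟩, h⟩
  · have hc := (split c c0 c1 hq hqx).resolve_left h
    refine Or.inr ⟨?_, hc⟩
    rintro ⟨q', hq', hqx', r, rx, rq', hr⟩
    by_cases hqq : q = q'
    · subst hqq
      have := (right c c0 c1 hq rq').1 hr
      have := c.mem hqx rq' rx
      omega
    -- Independence of the path: `q`, `q'` and `x` have a common point, and whether it is nearer to
    -- `p'` than to `p` does not depend on the path.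
    · have hadj := adj_of_mem hqq hq.1 hq'.1 hq.2 hq'.2 hpp
      obtain ⟨c', c0', c1'⟩ := M.exists_oriented_chart hq'.1 hq'.2 hpp
      have h1 := (right c' c0' c1' hq' rq').1 hr
      have h2 := c'.mem hqx' rq' rx
      have h3 := split c' c0' c1' hq' hqx'
      obtain ⟨t, tq, tq', tx⟩ := M.helly hadj hqx' hqx
      have h4 := c'.mem hqx' tq' tx
      have h5 := (right c c0 c1 hq tq).1 ((right c' c0' c1' hq' tq').2 (by omega))
      have h6 := c.mem hqx tq tx
      omega

/-- Nonadjacent vertices with a common neighbour on the edge from `p` to `p'`, and with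
incomparable neighbourhoods among the vertices through `p`, lie on opposite sides of this edge. -/
theorem beyond_iff_not {q u w x y : V} (hq : M.Has p p' q) (hx : ¬ M.Has p p' x)
    (hy : ¬ M.Has p p' y) (hqx : G.Adj q x) (hqy : G.Adj q y) (hxy : x ≠ y ∧ ¬ G.Adj x y)
    (hu : p ∈ M.pts u) (hqu : G.Adj q u) (hux : G.Adj u x) (huy : u ≠ y ∧ ¬ G.Adj u y)
    (hw : p ∈ M.pts w) (hqw : G.Adj q w) (hwy : G.Adj w y) (hwx : w ≠ x ∧ ¬ G.Adj w x) :
    M.Beyond p p' x ↔ ¬ M.Beyond p p' y := by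
  -- On the same side, the nearer of `x`, `y` would be covered on `q` by the path through `p` that
  -- reaches the farther one, namely `w` or `u`.
  obtain ⟨c, c0, c1⟩ := M.exists_oriented_chart hq.1 hq.2 hpp
  have h1 := c.side hpp c0 c1 hq hqx hx
  have h2 := c.side hpp c0 c1 hq hqy hy
  have h3 := c.disjoint hqx hqy hxy.1 hxy.2
  have h4 := c.mem hqu hq.1 hu
  have h5 := c.mem hqw hq.1 hw
  have h6 := c.disjoint hqu hqy huy.1 huy.2
  have h7 := c.disjoint hqw hqx hwx.1 hwx.2
  have h8 := c.touch hqu hqx hux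
  have h9 := c.touch hqw hqy hwy
  have l1 := c.lt hqx
  have l2 := c.lt hqy
  by_cases bx : M.Beyond p p' x <;> by_cases bt : M.Beyond p p' y <;> simp_all <;> omega

/-- On `q`, the path of `u` stops at `p`, so what it touches cannot be on the side of `p'`. -/
theorem not_beyond_of_adj {q u x : V} (hq : M.Has p p' q) (hx : ¬ M.Has p p' x)
    (hqx : G.Adj q x) (hu : p ∈ M.pts u) (hu' : p' ∉ M.pts u) (hqu : G.Adj q u)
    (hux : G.Adj u x) : ¬ M.Beyond p p' x := by
  obtain ⟨c, c0, c1⟩ := M.exists_oriented_chart hq.1 hq.2 hpp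
  have h1 := c.side hpp c0 c1 hq hqx hx
  have h4 := c.mem hqu hq.1 hu
  have h5 := mt (c.mem_iff (Or.inr hqu) hq.2).2 hu'
  have h8 := c.touch hqu hqx hux
  rcases h1 with ⟨-, h⟩ | ⟨h, -⟩
  · omega
  · exact h

end Side

end GeodesicModel

namespace GeodesicModel

variable {V : Type*} {G : SimpleGraph V} {M : GeodesicModel G}

section Side

variable {p p' : ℤ × ℤ} (hpp : gdist p p' = 1)
include hpp

/-- A vertex `c` attached to `q` and `a`, and an ear `e` attached to `q` and `q'`, lie on opposite
sides. -/
theorem beyond_attached_iff_not {q q' q'' a c e : V} (hq : M.Has p p' q) (hq' : M.Has p p' q')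
    (hq'' : M.Has p p' q'') (hqq' : q ≠ q') (hqq'' : q ≠ q'') (hc : ¬ M.Has p p' c)
    (he : ¬ M.Has p p' e) (hqc : G.Adj q c) (hac : G.Adj a c) (hq'c : q' ≠ c ∧ ¬ G.Adj q' c)
    (hqe : G.Adj q e) (hq'e : G.Adj q' e) (hq''e : q'' ≠ e ∧ ¬ G.Adj q'' e)
    (hae : a ≠ e ∧ ¬ G.Adj a e) (hqa : G.Adj q a) (hq''a : G.Adj q'' a)
    (hce : c ≠ e ∧ ¬ G.Adj c e) : M.Beyond p p' c ↔ ¬ M.Beyond p p' e := by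
  obtain ⟨d, d0, d1⟩ := M.exists_oriented_chart hq.1 hq.2 hpp
  have a' := adj_of_mem hqq' hq.1 hq'.1 hq.2 hq'.2 hpp
  have a'' := adj_of_mem hqq'' hq.1 hq''.1 hq.2 hq''.2 hpp
  have h1 := d.side hpp d0 d1 hq hqc hc
  have h2 := d.side hpp d0 d1 hq hqe he
  have h3 := d.disjoint hqc hqe hce.1 hce.2
  have h4 := d.mem a' hq.1 hq'.1
  have h4' := d.mem a' hq.2 hq'.2
  have h5 := d.mem a'' hq.1 hq''.1
  have h5' := d.mem a'' hq.2 hq''.2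
  have h6 := d.disjoint a' hqc hq'c.1 hq'c.2
  have h7 := d.disjoint a'' hqe hq''e.1 hq''e.2
  have h8 := d.disjoint hqa hqe hae.1 hae.2
  have h9 := d.touch hqa hqc hac
  have h10 := d.touch a' hqe hq'e
  have h11 := d.touch a'' hqa hq''a
  have l1 := d.lt hqc
  have l2 := d.lt hqe
  have l3 := d.lt hqa
  by_cases bx : M.Beyond p p' c <;> by_cases bt : M.Beyond p p' e <;> simp_all <;> omega

/-- Two adjacent vertices with a common neighbour `q` lie on the same side. -/
theorem has_or_beyond_iff {q a c : V} (hq : M.Has p p' q) (hqa : G.Adj q a) (hqc : G.Adj q c)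
    (hac : G.Adj a c) (hc : ¬ M.Has p p' c) :
    M.Has p p' a ∨ (M.Beyond p p' a ↔ M.Beyond p p' c) := by
  by_cases ha : M.Has p p' a
  · exact Or.inl ha
  obtain ⟨d, d0, d1⟩ := M.exists_oriented_chart hq.1 hq.2 hpp
  have h1 := d.side hpp d0 d1 hq hqc hc
  have h2 := d.side hpp d0 d1 hq hqa ha
  have h3 := d.touch hqa hqc hac
  right
  by_cases bx : M.Beyond p p' c <;> by_cases bt : M.Beyond p p' a <;> simp_all <;> omega

/-- If `b` lies on the side of `c`, then `a` lies on this side and, on the path `q`, is farther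
than `b` from the edge from `p` to `p'`. -/
theorem farther_of_attached {q q' a b c : V} (hq : M.Has p p' q) (hq' : M.Has p p' q')
    (hqq' : q ≠ q') (hc : ¬ M.Has p p' c) (hb : ¬ M.Has p p' b)
    (hqa : G.Adj q a) (hqb : G.Adj q b) (hq'b : G.Adj q' b) (hqc : G.Adj q c)
    (hac : G.Adj a c) (hq'c : q' ≠ c ∧ ¬ G.Adj q' c) (hab : a ≠ b ∧ ¬ G.Adj a b)
    (hbc : b ≠ c ∧ ¬ G.Adj b c) (hside : M.Beyond p p' b ↔ M.Beyond p p' c) :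
    ¬ M.Has p p' a ∧ (M.Beyond p p' a ↔ M.Beyond p p' b) ∧
      ∀ r s, r ∈ M.pts a → r ∈ M.pts q → s ∈ M.pts b → s ∈ M.pts q → gdist p s ≤ gdist p r := by
  obtain ⟨d, d0, d1⟩ := M.exists_oriented_chart hq.1 hq.2 hpp
  have a' := adj_of_mem hqq' hq.1 hq'.1 hq.2 hq'.2 hpp
  have h1 := d.side hpp d0 d1 hq hqc hc
  have h2 := d.side hpp d0 d1 hq hqb hb
  have h3 := d.disjoint hqa hqb hab.1 hab.2
  have h4 := d.disjoint hqb hqc hbc.1 hbc.2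
  have h5 := d.disjoint a' hqc hq'c.1 hq'c.2
  have h6 := d.mem a' hq.1 hq'.1
  have h6' := d.mem a' hq.2 hq'.2
  have h7 := d.touch a' hqb hq'b
  have h8 := d.touch hqa hqc hac
  have l1 := d.lt hqa
  have l2 := d.lt hqb
  have l3 := d.lt hqc
  -- Since `q'` reaches `b` but misses `c`, the vertex `b` is nearer than `c`; and `a` touches `c`
  -- while avoiding `b`.
  have key : (M.Beyond p p' b ∧ 1 ≤ d.lo b ∧ d.hi b ≤ d.lo a) ∨
      (¬ M.Beyond p p' b ∧ d.hi b ≤ 0 ∧ d.hi a ≤ d.lo b) := by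
    by_cases bx : M.Beyond p p' b <;> simp_all <;> omega
  have ha : ¬ M.Has p p' a := by
    intro ha
    have := d.mem hqa hq.1 ha.1
    have := d.mem hqa hq.2 ha.2
    omega
  have h9 := d.side hpp d0 d1 hq hqa ha
  refine ⟨ha, ?_, ?_⟩
  · by_cases bx : M.Beyond p p' b <;> by_cases bt : M.Beyond p p' a <;> simp_all <;> omega
  · intro r s ra rq sb sq
    have := d.mem hqa rq ra
    have := d.mem hqb sq sb
    rw [d.gdist_eq hq.1 sq, d.gdist_eq hq.1 rq, d0]
    omega

/-- Take a common point `r` of `q`, `q'` and `a`. The trace of `b` on `q` lies between `p` and `r`,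
hence also on `q'`, where `b` is at least as far as `a`. So both extreme points of the trace are as
far from `p` as `r` is, although they are distinct and on one side. -/
theorem false_of_farther {q q' a b : V} (hq : M.Has p p' q) (hq' : M.Has p p' q') (hqq' : q ≠ q')
    (hb : ¬ M.Has p p' b) (ha : ¬ M.Has p p' a)
    (hqa : G.Adj q a) (hqb : G.Adj q b) (hq'a : G.Adj q' a)
    (hside : M.Beyond p p' a ↔ M.Beyond p p' b)
    (h : ∀ r s, r ∈ M.pts a → r ∈ M.pts q → s ∈ M.pts b → s ∈ M.pts q → gdist p s ≤ gdist p r)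
    (h' : ∀ r s, r ∈ M.pts a → r ∈ M.pts q' → s ∈ M.pts b → s ∈ M.pts q' →
      gdist p r ≤ gdist p s) : False := by
  obtain ⟨d, d0, d1⟩ := M.exists_oriented_chart hq.1 hq.2 hpp
  have a' := adj_of_mem hqq' hq.1 hq'.1 hq.2 hq'.2 hpp
  obtain ⟨r, rq, rq', ra⟩ := M.helly a' hq'a hqa
  have h1 := d.side hpp d0 d1 hq hqa ha
  have h2 := d.side hpp d0 d1 hq hqb hb
  have mr := d.mem hqa rq ra
  have mr' := d.mem a' rq rq'
  have mp := d.mem a' hq.1 hq'.1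
  have l := d.lt hqb
  obtain ⟨s, sq, sb, es⟩ := d.exists_point (Or.inr hqb) le_rfl l.le
  obtain ⟨t, tq, tb, et⟩ := d.exists_point (Or.inr hqb) l.le le_rfl
  have h3 := h r s ra rq sb sq
  have h4 := h r t ra rq tb tq
  have h5 : s ∈ M.pts q' → gdist p r ≤ gdist p s := h' r s ra rq' sb
  have h6 : t ∈ M.pts q' → gdist p r ≤ gdist p t := h' r t ra rq' tb
  rw [d.mem_iff (Or.inr a') sq] at h5
  rw [d.mem_iff (Or.inr a') tq] at h6
  rw [d.gdist_eq hq.1 sq, d.gdist_eq hq.1 rq, d0] at h3 h5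
  rw [d.gdist_eq hq.1 tq, d.gdist_eq hq.1 rq, d0] at h4 h6
  rcases h1 with ⟨k1, h1⟩ | ⟨k1, h1⟩ <;> rcases h2 with ⟨k2, h2⟩ | ⟨k2, h2⟩ <;>
    first | exact k2 (hside.1 k1) | exact k1 (hside.2 k2) | omega

end Side

end GeodesicModel

/-! ### Ear systems and parity -/

/-- A clique `q 0, …, q (m - 1)` and pairwise nonadjacent vertices `e 0, …, e (n - 1)`, the vertex
`e i` being adjacent to `q i` and to `q (i + 1)`, where `q m` is `q 0`. -/
structure EarSystem {V : Type*} (G : SimpleGraph V) (m n : ℕ) where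
  q : ℕ → V
  e : ℕ → V
  three_le : 3 ≤ m
  le : n ≤ m
  clique_adj : ∀ {i j}, i < m → j < m → i ≠ j → G.Adj (q i) (q j)
  ear_adj : ∀ {i j}, i < n → j < m → (G.Adj (q j) (e i) ↔ j = i ∨ j = i + 1 ∨ (i + 1 = m ∧ j = 0))
  ear_ear : ∀ {i j}, i < n → j < n → i ≠ j → e i ≠ e j ∧ ¬ G.Adj (e i) (e j)
  clique_ne_ear : ∀ {i j}, j < m → i < n → q j ≠ e i

namespace EarSystem

open GeodesicModel

variable {V : Type*} {G : SimpleGraph V} {M : GeodesicModel G} {m n : ℕ} (S : EarSystem G m n)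
include S

theorem isClique : G.IsClique (S.q '' {i | i < m}) := by
  rintro _ ⟨i, hi, rfl⟩ _ ⟨j, hj, rfl⟩ hij
  exact S.clique_adj hi hj (by rintro rfl; exact hij rfl)

theorem not_ear_adj {i j : ℕ} (hi : i < n) (hj : j < m)
    (h : ¬ (j = i ∨ j = i + 1 ∨ (i + 1 = m ∧ j = 0))) : S.q j ≠ S.e i ∧ ¬ G.Adj (S.q j) (S.e i) :=
  ⟨S.clique_ne_ear hj hi, fun hadj => h ((S.ear_adj hi hj).1 hadj)⟩

/-- There is a common grid edge of `q j`, `j ∈ J`, that has an end point on all the `q i`. -/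
theorem exists_edge (M : GeodesicModel G) (J : Set ℕ) (hJ : ∀ j ∈ J, j < m) (hne : J.Nonempty)
    {z w : V}
    (hzw : z ≠ w ∧ ¬ G.Adj z w) (hz : ∀ j ∈ J, G.Adj (S.q j) z) (hw : ∀ j ∈ J, G.Adj (S.q j) w) :
    ∃ p p', gdist p p' = 1 ∧ (∀ i < m, p ∈ M.pts (S.q i)) ∧ ∀ j ∈ J, M.Has p p' (S.q j) := by
  obtain ⟨p, p', h, hp, hp'⟩ := M.exists_common_edge_at (K := S.q '' J) S.isClique
    (Set.image_mono hJ) (hne.image _) hzw.1 hzw.2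
    (by rintro _ ⟨j, hj, rfl⟩; exact hz j hj) (by rintro _ ⟨j, hj, rfl⟩; exact hw j hj)
  have hp : ∀ i < m, p ∈ M.pts (S.q i) := fun i hi => hp _ ⟨i, hi, rfl⟩
  exact ⟨p, p', h, hp, fun j hj => ⟨hp j (hJ j hj), hp' _ ⟨j, hj, rfl⟩⟩⟩

section Side

variable {p p' : ℤ × ℤ} (hpp : gdist p p' = 1)
include hpp

theorem not_has_ear {i j : ℕ} (hi : i < n) (hj : j < m)
    (h : ¬ (j = i ∨ j = i + 1 ∨ (i + 1 = m ∧ j = 0))) (hq : M.Has p p' (S.q j)) :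
    ¬ M.Has p p' (S.e i) :=
  not_has hpp hq (S.not_ear_adj hi hj h).1 (S.not_ear_adj hi hj h).2

/-- Consecutive ears lie on opposite sides. -/
theorem beyond_ear_iff (hp : ∀ i < m, p ∈ M.pts (S.q i))
    (hp' : ∀ i, i + 1 < n → M.Has p p' (S.q (i + 1))) (he : ∀ i < n, ¬ M.Has p p' (S.e i))
    (i : ℕ) (hi : i < n) : M.Beyond p p' (S.e i) ↔ (M.Beyond p p' (S.e 0) ↔ Even i) := by
  have hm := S.three_le
  have hn := S.le
  induction i with
  | zero => simp
  | succ i ih =>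
    have h : M.Beyond p p' (S.e i) ↔ ¬ M.Beyond p p' (S.e (i + 1)) := by
      -- Here `q j` is the end of the ear `i + 1` other than `q (i + 1)`: it is `q (i + 2)`, or `q
      -- 0` when the indices wrap around.
      have key : ∀ j < m, j ≠ i → j ≠ i + 1 → G.Adj (S.q j) (S.e (i + 1)) →
          ¬ G.Adj (S.q j) (S.e i) → (M.Beyond p p' (S.e i) ↔ ¬ M.Beyond p p' (S.e (i + 1))) := by
        intro j hj h1 h2 h3 h4
        exact beyond_iff_not hpp (hp' i hi) (he i (by omega)) (he (i + 1) hi)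
          ((S.ear_adj (by omega) (by omega)).2 (by omega))
          ((S.ear_adj (by omega) (by omega)).2 (by omega))
          (S.ear_ear (by omega) (by omega) (by omega)) (hp i (by omega))
          (S.clique_adj (by omega) (by omega) (by omega))
          ((S.ear_adj (by omega) (by omega)).2 (by omega))
          (S.not_ear_adj hi (by omega) (by omega)) (hp j hj)
          (S.clique_adj (by omega) (by omega) (by omega)) h3 ⟨S.clique_ne_ear hj (by omega), h4⟩
      by_cases h2 : i + 2 < m
      · exact key (i + 2) h2 (by omega) (by omega) ((S.ear_adj hi h2).2 (by omega))
          (S.not_ear_adj (by omega) h2 (by omega)).2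
      · exact key 0 (by omega) (by omega) (by omega) ((S.ear_adj hi (by omega)).2 (by omega))
          (S.not_ear_adj (by omega) (by omega) (by omega)).2
    have h2 := ih (by omega)
    rw [Nat.even_add_one]
    tauto

end Side

end EarSystem

namespace EarSystem

open GeodesicModel

variable {V : Type*} {G : SimpleGraph V} {m n : ℕ}

/-- Sides alternate around an odd cycle of ears. -/
theorem false_of_odd_sun (M : GeodesicModel G) (S : EarSystem G m m) (hm : Odd m) {a b : V}
    (hab : a ≠ b ∧ ¬ G.Adj a b) (ha : ∀ j < m, G.Adj (S.q j) a) (hb : ∀ j < m, G.Adj (S.q j) b) :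
    False := by
  have h3 := S.three_le
  obtain ⟨p, p', hpp, hp, hp'⟩ := S.exists_edge M {j | j < m} (fun _ h => h)
    ⟨0, show 0 < m by omega⟩ hab ha hb
  have he : ∀ i < m, ¬ M.Has p p' (S.e i) := by
    intro i hi
    rcases (show i = 0 ∨ i = 1 ∨ 2 ≤ i by omega) with h | h | h
    · exact S.not_has_ear hpp hi (show 2 < m by omega) (by omega) (hp' 2 (show 2 < m by omega))
    · exact S.not_has_ear hpp hi (show 0 < m by omega) (by omega) (hp' 0 (show 0 < m by omega))
    · exact S.not_has_ear hpp hi (show 1 < m by omega) (by omega) (hp' 1 (show 1 < m by omega))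
  have h1 := S.beyond_ear_iff hpp hp (fun i hi => hp' _ hi) he (m - 1) (by omega)
  have h2 : M.Beyond p p' (S.e 0) ↔ ¬ M.Beyond p p' (S.e (m - 1)) :=
    beyond_iff_not hpp (hp' 0 (show 0 < m by omega)) (he 0 (by omega)) (he (m - 1) (by omega))
      ((S.ear_adj (by omega) (by omega)).2 (by omega))
      ((S.ear_adj (by omega) (by omega)).2 (by omega))
      (S.ear_ear (by omega) (by omega) (by omega)) (hp 1 (by omega))
      (S.clique_adj (by omega) (by omega) (by omega))
      ((S.ear_adj (by omega) (by omega)).2 (by omega))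
      (S.not_ear_adj (by omega) (by omega) (by omega)) (hp (m - 1) (by omega))
      (S.clique_adj (by omega) (by omega) (by omega))
      ((S.ear_adj (by omega) (by omega)).2 (by omega))
      (S.not_ear_adj (by omega) (by omega) (by omega))
  have h3 : Even (m - 1) := by
    obtain ⟨k, hk⟩ := hm
    exact ⟨k, by omega⟩
  tauto

/-- The ears `0` and `2 * k - 2` are on one side, and `b` is opposite to it. If `q 0` contains the
edge, `a` is also opposite to that side, yet opposite to `b`. Otherwise the ear `0` and `b` both
touch `q 0`, which stops at `p`, so they are on the same side. -/
theorem false_of_two_missing (M : GeodesicModel G) {k : ℕ} (hk : 2 ≤ k)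
    (S : EarSystem G (2 * k) (2 * k - 1)) {a b : V}
    (hab : a ≠ b ∧ ¬ G.Adj a b)
    (ha : ∀ j < 2 * k, S.q j ≠ a ∧ (G.Adj (S.q j) a ↔ j ≠ 0))
    (hb : ∀ j < 2 * k, S.q j ≠ b ∧ (G.Adj (S.q j) b ↔ j ≠ 2 * k - 1))
    (hae : ∀ i < 2 * k - 1, a ≠ S.e i ∧ ¬ G.Adj a (S.e i))
    (hbe : ∀ i < 2 * k - 1, b ≠ S.e i ∧ ¬ G.Adj b (S.e i)) : False := by
  have key : ∀ j, 0 < j → j < 2 * k → G.Adj (S.q j) a := fun j h h' => (ha j h').2.2 (by omega)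
  have hqa : S.q 0 ≠ a ∧ ¬ G.Adj (S.q 0) a := ⟨(ha 0 (by omega)).1, by
    rw [(ha 0 (by omega)).2]; simp⟩
  have hqb : S.q (2 * k - 1) ≠ b ∧ ¬ G.Adj (S.q (2 * k - 1)) b := ⟨(hb _ (by omega)).1, by
    rw [(hb _ (by omega)).2]; simp⟩
  have keyb : ∀ j, j < 2 * k - 1 → G.Adj (S.q j) b :=
    fun j h => (hb j (by omega)).2.2 (by omega)
  -- The nonadjacent common neighbours of the smaller clique are `a` and `q 0` itself.
  obtain ⟨p, p', hpp, hp, hp'⟩ := S.exists_edge M {j | 0 < j ∧ j < 2 * k} (fun _ h => h.2)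
    ⟨1, show 0 < 1 ∧ 1 < 2 * k by omega⟩ (w := a) (z := S.q 0) hqa
    (fun j hj => S.clique_adj hj.2 (by omega) hj.1.ne') (fun j hj => key j hj.1 hj.2)
  have hK : ∀ j, 0 < j → j < 2 * k → M.Has p p' (S.q j) := fun j h h' => hp' j ⟨h, h'⟩
  have he : ∀ i < 2 * k - 1, ¬ M.Has p p' (S.e i) := by
    intro i hi
    rcases (show i = 0 ∨ i = 1 ∨ 2 ≤ i by omega) with h | h | h
    · exact S.not_has_ear hpp hi (j := 2) (by omega) (by omega) (hK 2 (by omega) (by omega))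
    · exact S.not_has_ear hpp hi (j := 3) (by omega) (by omega) (hK 3 (by omega) (by omega))
    · exact S.not_has_ear hpp hi (j := 1) (by omega) (by omega) (hK 1 (by omega) (by omega))
  have alt := S.beyond_ear_iff hpp hp (fun i hi => hK _ (by omega) (by omega)) he (2 * k - 2)
    (by omega)
  have hev : Even (2 * k - 2) := ⟨k - 1, by omega⟩
  have hb0 : ¬ M.Has p p' b := not_has hpp (hK _ (by omega) (by omega)) hqb.1 hqb.2
  have oppb : M.Beyond p p' b ↔ ¬ M.Beyond p p' (S.e (2 * k - 2)) :=
    beyond_iff_not hpp (hK (2 * k - 2) (by omega) (by omega)) hb0 (he _ (by omega))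
      (keyb _ (by omega)) ((S.ear_adj (by omega) (by omega)).2 (by omega)) (hbe _ (by omega))
      (hp 0 (by omega)) (S.clique_adj (by omega) (by omega) (by omega)) (keyb _ (by omega))
      (S.not_ear_adj (by omega) (by omega) (by omega)) (hp (2 * k - 1) (by omega))
      (S.clique_adj (by omega) (by omega) (by omega))
      ((S.ear_adj (by omega) (by omega)).2 (by omega)) hqb
  by_cases h0 : M.Has p p' (S.q 0)
  · have ha0 : ¬ M.Has p p' a := not_has hpp h0 hqa.1 hqa.2
    have oppa : M.Beyond p p' a ↔ ¬ M.Beyond p p' (S.e 0) :=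
      beyond_iff_not hpp (hK 1 (by omega) (by omega)) ha0 (he _ (by omega))
        (key _ (by omega) (by omega)) ((S.ear_adj (by omega) (by omega)).2 (by omega))
        (hae _ (by omega)) (hp 2 (by omega)) (S.clique_adj (by omega) (by omega) (by omega))
        (key _ (by omega) (by omega)) (S.not_ear_adj (by omega) (by omega) (by omega))
        (hp 0 (by omega)) (S.clique_adj (by omega) (by omega) (by omega))
        ((S.ear_adj (by omega) (by omega)).2 (by omega)) hqa
    have oppab : M.Beyond p p' a ↔ ¬ M.Beyond p p' b :=
      beyond_iff_not hpp (hK 1 (by omega) (by omega)) ha0 hb0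
        (key _ (by omega) (by omega)) (keyb _ (by omega)) hab
        (hp (2 * k - 1) (by omega)) (S.clique_adj (by omega) (by omega) (by omega))
        (key _ (by omega) (by omega)) hqb (hp 0 (by omega))
        (S.clique_adj (by omega) (by omega) (by omega)) (keyb _ (by omega)) hqa
    tauto
  · have hp'0 : p' ∉ M.pts (S.q 0) := fun h => h0 ⟨hp 0 (by omega), h⟩
    have n0 : ¬ M.Beyond p p' (S.e 0) :=
      not_beyond_of_adj hpp (hK 1 (by omega) (by omega)) (he 0 (by omega))
        ((S.ear_adj (by omega) (by omega)).2 (by omega)) (hp 0 (by omega)) hp'0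
        (S.clique_adj (by omega) (by omega) (by omega))
        ((S.ear_adj (by omega) (by omega)).2 (by omega))
    have nb : ¬ M.Beyond p p' b :=
      not_beyond_of_adj hpp (hK 1 (by omega) (by omega)) hb0
        (keyb _ (by omega)) (hp 0 (by omega)) hp'0
        (S.clique_adj (by omega) (by omega) (by omega)) (keyb _ (by omega))
    tauto

/-- By parity the two ears at `q 0` are on opposite sides. If `q 0` contains the edge, both are
opposite to `a`; otherwise both are on the side of `p`. -/
theorem false_of_even_sun (M : GeodesicModel G) {k : ℕ} (hk : 2 ≤ k)
    (S : EarSystem G (2 * k) (2 * k)) {a : V}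
    (ha : ∀ j < 2 * k, S.q j ≠ a ∧ (G.Adj (S.q j) a ↔ j ≠ 0))
    (hae : ∀ i < 2 * k, a ≠ S.e i ∧ ¬ G.Adj a (S.e i)) : False := by
  have key : ∀ j, 0 < j → j < 2 * k → G.Adj (S.q j) a := fun j h h' => (ha j h').2.2 (by omega)
  have hqa : S.q 0 ≠ a ∧ ¬ G.Adj (S.q 0) a := ⟨(ha 0 (by omega)).1, by
    rw [(ha 0 (by omega)).2]; simp⟩
  obtain ⟨p, p', hpp, hp, hp'⟩ := S.exists_edge M {j | 0 < j ∧ j < 2 * k} (fun _ h => h.2)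
    ⟨1, show 0 < 1 ∧ 1 < 2 * k by omega⟩ (w := a) (z := S.q 0) hqa
    (fun j hj => S.clique_adj hj.2 (by omega) hj.1.ne') (fun j hj => key j hj.1 hj.2)
  have hK : ∀ j, 0 < j → j < 2 * k → M.Has p p' (S.q j) := fun j h h' => hp' j ⟨h, h'⟩
  have he : ∀ i < 2 * k, ¬ M.Has p p' (S.e i) := by
    intro i hi
    rcases (show i = 0 ∨ i = 1 ∨ 2 ≤ i by omega) with h | h | h
    · exact S.not_has_ear hpp hi (j := 2) (by omega) (by omega) (hK 2 (by omega) (by omega))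
    · exact S.not_has_ear hpp hi (j := 3) (by omega) (by omega) (hK 3 (by omega) (by omega))
    · exact S.not_has_ear hpp hi (j := 1) (by omega) (by omega) (hK 1 (by omega) (by omega))
  have alt := S.beyond_ear_iff hpp hp (fun i hi => hK _ (by omega) (by omega)) he (2 * k - 1)
    (by omega)
  have hodd : ¬ Even (2 * k - 1) := by
    rintro ⟨l, hl⟩
    omega
  by_cases h0 : M.Has p p' (S.q 0)
  · have ha0 : ¬ M.Has p p' a := not_has hpp h0 hqa.1 hqa.2
    have opp : M.Beyond p p' a ↔ ¬ M.Beyond p p' (S.e 0) :=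
      beyond_iff_not hpp (hK 1 (by omega) (by omega)) ha0 (he _ (by omega))
        (key _ (by omega) (by omega)) ((S.ear_adj (by omega) (by omega)).2 (by omega))
        (hae _ (by omega)) (hp 2 (by omega)) (S.clique_adj (by omega) (by omega) (by omega))
        (key _ (by omega) (by omega)) (S.not_ear_adj (by omega) (by omega) (by omega))
        (hp 0 (by omega)) (S.clique_adj (by omega) (by omega) (by omega))
        ((S.ear_adj (by omega) (by omega)).2 (by omega)) hqa
    have opp' : M.Beyond p p' a ↔ ¬ M.Beyond p p' (S.e (2 * k - 1)) :=
      beyond_iff_not hpp (hK (2 * k - 1) (by omega) (by omega)) ha0 (he _ (by omega))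
        (key _ (by omega) (by omega)) ((S.ear_adj (by omega) (by omega)).2 (by omega))
        (hae _ (by omega)) (hp 1 (by omega)) (S.clique_adj (by omega) (by omega) (by omega))
        (key _ (by omega) (by omega)) (S.not_ear_adj (by omega) (by omega) (by omega))
        (hp 0 (by omega)) (S.clique_adj (by omega) (by omega) (by omega))
        ((S.ear_adj (by omega) (by omega)).2 (by omega)) hqa
    tauto
  · have hp'0 : p' ∉ M.pts (S.q 0) := fun h => h0 ⟨hp 0 (by omega), h⟩
    have n0 : ¬ M.Beyond p p' (S.e 0) :=
      not_beyond_of_adj hpp (hK 1 (by omega) (by omega)) (he 0 (by omega))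
        ((S.ear_adj (by omega) (by omega)).2 (by omega)) (hp 0 (by omega)) hp'0
        (S.clique_adj (by omega) (by omega) (by omega))
        ((S.ear_adj (by omega) (by omega)).2 (by omega))
    have n1 : ¬ M.Beyond p p' (S.e (2 * k - 1)) :=
      not_beyond_of_adj hpp (hK (2 * k - 1) (by omega) (by omega)) (he _ (by omega))
        ((S.ear_adj (by omega) (by omega)).2 (by omega)) (hp 0 (by omega)) hp'0
        (S.clique_adj (by omega) (by omega) (by omega))
        ((S.ear_adj (by omega) (by omega)).2 (by omega))
    tauto

/-- By parity the first and the last ear are on opposite sides. If `a` contains the edge, neither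
end of the clique does, and both ears are on the side of `p`; otherwise both are opposite to `a`. -/
theorem false_of_ends_missing (M : GeodesicModel G) {k : ℕ} (hk : 2 ≤ k)
    (S : EarSystem G (2 * k + 1) (2 * k)) {a : V}
    (ha : ∀ j < 2 * k + 1, S.q j ≠ a ∧ (G.Adj (S.q j) a ↔ j ≠ 0 ∧ j ≠ 2 * k))
    (hae : ∀ i < 2 * k, a ≠ S.e i ∧ ¬ G.Adj a (S.e i)) : False := by
  have key : ∀ j, 0 < j → j < 2 * k → G.Adj (S.q j) a :=
    fun j h h' => (ha j (by omega)).2.2 (by omega)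
  have hqa : S.q 0 ≠ a ∧ ¬ G.Adj (S.q 0) a := ⟨(ha 0 (by omega)).1, by
    rw [(ha 0 (by omega)).2]; simp⟩
  have hqa' : S.q (2 * k) ≠ a ∧ ¬ G.Adj (S.q (2 * k)) a := ⟨(ha _ (by omega)).1, by
    rw [(ha _ (by omega)).2]; simp⟩
  obtain ⟨p, p', hpp, hp, hp'⟩ := S.exists_edge M {j | 0 < j ∧ j < 2 * k}
    (fun _ h => h.2.trans (by omega)) ⟨1, show 0 < 1 ∧ 1 < 2 * k by omega⟩ (w := a) (z := S.q 0) hqa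
    (fun j hj => S.clique_adj (hj.2.trans (by omega)) (by omega) hj.1.ne')
    (fun j hj => key j hj.1 hj.2)
  have hK : ∀ j, 0 < j → j < 2 * k → M.Has p p' (S.q j) := fun j h h' => hp' j ⟨h, h'⟩
  have he : ∀ i < 2 * k, ¬ M.Has p p' (S.e i) := by
    intro i hi
    rcases (show i = 0 ∨ i = 1 ∨ 2 ≤ i by omega) with h | h | h
    · exact S.not_has_ear hpp hi (j := 2) (by omega) (by omega) (hK 2 (by omega) (by omega))
    · exact S.not_has_ear hpp hi (j := 3) (by omega) (by omega) (hK 3 (by omega) (by omega))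
    · exact S.not_has_ear hpp hi (j := 1) (by omega) (by omega) (hK 1 (by omega) (by omega))
  have alt := S.beyond_ear_iff hpp hp (fun i hi => hK _ (by omega) (by omega)) he (2 * k - 1)
    (by omega)
  have hodd : ¬ Even (2 * k - 1) := by
    rintro ⟨l, hl⟩
    omega
  by_cases ha0 : M.Has p p' a
  · have hp'0 : p' ∉ M.pts (S.q 0) :=
      fun h => not_has hpp ⟨hp 0 (by omega), h⟩ hqa.1 hqa.2 ha0
    have hp'1 : p' ∉ M.pts (S.q (2 * k)) :=
      fun h => not_has hpp ⟨hp _ (by omega), h⟩ hqa'.1 hqa'.2 ha0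
    have n0 : ¬ M.Beyond p p' (S.e 0) :=
      not_beyond_of_adj hpp (hK 1 (by omega) (by omega)) (he 0 (by omega))
        ((S.ear_adj (by omega) (by omega)).2 (by omega)) (hp 0 (by omega)) hp'0
        (S.clique_adj (by omega) (by omega) (by omega))
        ((S.ear_adj (by omega) (by omega)).2 (by omega))
    have n1 : ¬ M.Beyond p p' (S.e (2 * k - 1)) :=
      not_beyond_of_adj hpp (hK (2 * k - 1) (by omega) (by omega)) (he _ (by omega))
        ((S.ear_adj (by omega) (by omega)).2 (by omega)) (hp _ (by omega)) hp'1
        (S.clique_adj (by omega) (by omega) (by omega))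
        ((S.ear_adj (by omega) (by omega)).2 (by omega))
    tauto
  · have opp : M.Beyond p p' a ↔ ¬ M.Beyond p p' (S.e 0) :=
      beyond_iff_not hpp (hK 1 (by omega) (by omega)) ha0 (he _ (by omega))
        (key _ (by omega) (by omega)) ((S.ear_adj (by omega) (by omega)).2 (by omega))
        (hae _ (by omega)) (hp 2 (by omega)) (S.clique_adj (by omega) (by omega) (by omega))
        (key _ (by omega) (by omega)) (S.not_ear_adj (by omega) (by omega) (by omega))
        (hp 0 (by omega)) (S.clique_adj (by omega) (by omega) (by omega))
        ((S.ear_adj (by omega) (by omega)).2 (by omega)) hqa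
    have opp' : M.Beyond p p' a ↔ ¬ M.Beyond p p' (S.e (2 * k - 1)) :=
      beyond_iff_not hpp (hK (2 * k - 1) (by omega) (by omega)) ha0 (he _ (by omega))
        (key _ (by omega) (by omega)) ((S.ear_adj (by omega) (by omega)).2 (by omega))
        (hae _ (by omega)) (hp 1 (by omega)) (S.clique_adj (by omega) (by omega) (by omega))
        (key _ (by omega) (by omega)) (S.not_ear_adj (by omega) (by omega) (by omega))
        (hp (2 * k) (by omega)) (S.clique_adj (by omega) (by omega) (by omega))
        ((S.ear_adj (by omega) (by omega)).2 (by omega)) hqa'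
    tauto

/-- The first and the last ear are on one side, and `c` and `d` are opposite to them. Since `a` and
`b` cannot both contain the edge, it follows that neither does and that both lie on the side of `c`
and `d`. Then `a` is farther than `b` on the first clique path, and `b` farther than `a` on the
last. -/
theorem false_of_attached (M : GeodesicModel G) {k : ℕ} (hk : 2 ≤ k)
    (S : EarSystem G (2 * k) (2 * k - 1)) {a b c d : V}
    (hab : a ≠ b ∧ ¬ G.Adj a b) (hac : G.Adj a c) (hbd : G.Adj b d)
    (hbc : b ≠ c ∧ ¬ G.Adj b c) (had : a ≠ d ∧ ¬ G.Adj a d)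
    (ha : ∀ j < 2 * k, G.Adj (S.q j) a) (hb : ∀ j < 2 * k, G.Adj (S.q j) b)
    (hc : ∀ j < 2 * k, S.q j ≠ c ∧ (G.Adj (S.q j) c ↔ j = 0))
    (hd : ∀ j < 2 * k, S.q j ≠ d ∧ (G.Adj (S.q j) d ↔ j = 2 * k - 1))
    (hae : ∀ i < 2 * k - 1, a ≠ S.e i ∧ ¬ G.Adj a (S.e i))
    (hbe : ∀ i < 2 * k - 1, b ≠ S.e i ∧ ¬ G.Adj b (S.e i))
    (hce : ∀ i < 2 * k - 1, c ≠ S.e i ∧ ¬ G.Adj c (S.e i))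
    (hde : ∀ i < 2 * k - 1, d ≠ S.e i ∧ ¬ G.Adj d (S.e i)) : False := by
  obtain ⟨p, p', hpp, hp, hp'⟩ := S.exists_edge M {j | j < 2 * k} (fun _ h => h)
    ⟨1, show 1 < 2 * k by omega⟩ hab ha hb
  have hK : ∀ j < 2 * k, M.Has p p' (S.q j) := hp'
  have he : ∀ i < 2 * k - 1, ¬ M.Has p p' (S.e i) := by
    intro i hi
    rcases (show i = 0 ∨ i = 1 ∨ 2 ≤ i by omega) with h | h | h
    · exact S.not_has_ear hpp hi (j := 2) (by omega) (by omega) (hK 2 (by omega))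
    · exact S.not_has_ear hpp hi (j := 3) (by omega) (by omega) (hK 3 (by omega))
    · exact S.not_has_ear hpp hi (j := 1) (by omega) (by omega) (hK 1 (by omega))
  have alt := S.beyond_ear_iff hpp hp (fun i hi => hK _ (by omega)) he (2 * k - 2)
    (by omega)
  rw [iff_true_intro (show Even (2 * k - 2) from ⟨k - 1, by omega⟩), iff_true] at alt
  have nc : ∀ j, 0 < j → j < 2 * k → S.q j ≠ c ∧ ¬ G.Adj (S.q j) c :=
    fun j h h' => ⟨(hc j h').1, by rw [(hc j h').2]; omega⟩
  have nd : ∀ j < 2 * k - 1, S.q j ≠ d ∧ ¬ G.Adj (S.q j) d :=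
    fun j h => ⟨(hd j (by omega)).1, by rw [(hd j (by omega)).2]; omega⟩
  have qc : G.Adj (S.q 0) c := (hc 0 (by omega)).2.2 rfl
  have qd : G.Adj (S.q (2 * k - 1)) d := (hd _ (by omega)).2.2 rfl
  have ne : ∀ {i j}, i < 2 * k → j < 2 * k → i ≠ j → S.q i ≠ S.q j :=
    fun h h' h'' => (S.clique_adj h h' h'').ne
  have c0 : ¬ M.Has p p' c :=
    not_has hpp (hK 1 (by omega)) (nc 1 (by omega) (by omega)).1 (nc 1 (by omega) (by omega)).2
  have d0 : ¬ M.Has p p' d :=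
    not_has hpp (hK 0 (by omega)) (nd 0 (by omega)).1 (nd 0 (by omega)).2
  have oppc : M.Beyond p p' c ↔ ¬ M.Beyond p p' (S.e 0) :=
    beyond_attached_iff_not hpp (hK 0 (by omega)) (hK 1 (by omega)) (hK 2 (by omega))
      (ne (by omega) (by omega) (by omega)) (ne (by omega) (by omega) (by omega)) c0
      (he 0 (by omega)) qc hac (nc 1 (by omega) (by omega))
      ((S.ear_adj (by omega) (by omega)).2 (by omega))
      ((S.ear_adj (by omega) (by omega)).2 (by omega))
      (S.not_ear_adj (by omega) (by omega) (by omega)) (hae 0 (by omega)) (ha 0 (by omega))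
      (ha 2 (by omega)) (hce 0 (by omega))
  have oppd : M.Beyond p p' d ↔ ¬ M.Beyond p p' (S.e (2 * k - 2)) :=
    beyond_attached_iff_not hpp (hK (2 * k - 1) (by omega)) (hK (2 * k - 2) (by omega))
      (hK 0 (by omega))
      (ne (by omega) (by omega) (by omega)) (ne (by omega) (by omega) (by omega)) d0
      (he _ (by omega)) qd hbd (nd _ (by omega))
      ((S.ear_adj (by omega) (by omega)).2 (by omega))
      ((S.ear_adj (by omega) (by omega)).2 (by omega))
      (S.not_ear_adj (by omega) (by omega) (by omega)) (hbe _ (by omega)) (hb _ (by omega))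
      (hb 0 (by omega)) (hde _ (by omega))
  have hdc := oppd.trans ((not_congr alt).trans oppc.symm)
  have sa := has_or_beyond_iff hpp (hK 0 (by omega)) (ha 0 (by omega)) qc hac c0
  have sb := has_or_beyond_iff hpp (hK (2 * k - 1) (by omega)) (hb _ (by omega)) qd hbd d0
  have fa : ¬ M.Has p p' b → _ := fun hb' =>
    farther_of_attached hpp (hK 0 (by omega)) (hK (2 * k - 1) (by omega))
      (ne (by omega) (by omega) (by omega)) c0 hb' (ha 0 (by omega)) (hb 0 (by omega))
      (hb _ (by omega)) qc hac (nc _ (by omega) (by omega)) hab hbc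
      ((sb.resolve_left hb').trans hdc)
  have fb : ¬ M.Has p p' a → _ := fun ha' =>
    farther_of_attached hpp (hK (2 * k - 1) (by omega)) (hK 0 (by omega))
      (ne (by omega) (by omega) (by omega)) d0 ha' (hb _ (by omega)) (ha _ (by omega))
      (ha 0 (by omega)) qd hbd (nd 0 (by omega)) ⟨hab.1.symm, fun h => hab.2 h.symm⟩ had
      ((sa.resolve_left ha').trans hdc.symm)
  have hnot : ¬ M.Has p p' a ∧ ¬ M.Has p p' b := by
    by_cases h : M.Has p p' a
    · exact absurd h (fa fun h' => not_has hpp h hab.1 hab.2 h').1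
    · exact ⟨h, (fb h).1⟩
  obtain ⟨-, h1, h2⟩ := fa hnot.2
  obtain ⟨-, -, h3⟩ := fb hnot.1
  exact false_of_farther hpp (hK 0 (by omega)) (hK (2 * k - 1) (by omega))
    (ne (by omega) (by omega) (by omega)) hnot.2 hnot.1 (ha 0 (by omega)) (hb 0 (by omega))
    (ha _ (by omega)) h1 h2 (fun r s ra rq sb sq => h3 s r sb sq ra rq)

end EarSystem

/-! ### The graphs with ears -/

/-- The clique and the ears of an `earGraph`. -/
def EarVertex.system {m n t : ℕ} (r : EarVertex m n t → EarVertex m n t → Prop) (hm : 3 ≤ m)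
    (hn : 0 < n) (hnm : n ≤ m) (hce : ∀ i j, ¬ r (.clique i) (.ear j))
    (hee : ∀ i j, ¬ r (.ear i) (.ear j)) : EarSystem (earGraph m n t r) m n where
  -- The reductions modulo `m` and `n` only make the sequences total on `ℕ`.
  q i := .clique ⟨i % m, Nat.mod_lt _ (by omega)⟩
  e i := .ear ⟨i % n, Nat.mod_lt _ hn⟩
  three_le := hm
  le := hnm
  clique_adj {i j} hi hj hij := by
    simp [earGraph, Nat.mod_eq_of_lt hi, Nat.mod_eq_of_lt hj, hij]
  ear_adj {i j} hi hj := by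
    have h : j = (i + 1) % m ↔ j = i + 1 ∨ (i + 1 = m ∧ j = 0) := by
      rcases (show i + 1 < m ∨ i + 1 = m by omega) with h | h
      · rw [Nat.mod_eq_of_lt h]; omega
      · rw [h, Nat.mod_self]; omega
    simp [earGraph, Nat.mod_eq_of_lt hi, Nat.mod_eq_of_lt hj, h, hce]
  ear_ear {i j} hi hj hij := by
    simp [earGraph, hee, Nat.mod_eq_of_lt hi, Nat.mod_eq_of_lt hj, hij]
  clique_ne_ear _ _ := by simp

theorem not_isBkEPG_F11 {k : ℕ} (hk : 2 ≤ k) : ¬ IsBkEPG 1 (F11 k) := by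
  intro h
  obtain ⟨M⟩ := h.nonempty_geodesicModel
  exact (EarVertex.system _ (by omega) (by omega) le_rfl (by simp) (by simp)).false_of_odd_sun M
    ⟨k - 1, by omega⟩ (a := .extra 0) (b := .extra 1) (by simp [F11, earGraph])
    (by intro j hj; simp [EarVertex.system, F11, earGraph])
    (by intro j hj; simp [EarVertex.system, F11, earGraph])

/-- The edge from an ear to `b` is harmless: the parity argument only needs `a` and `b` to be
nonadjacent and joined to the whole clique. -/
theorem not_isBkEPG_F12 {k : ℕ} (hk : 2 ≤ k) : ¬ IsBkEPG 1 (F12 k) := by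
  intro h
  obtain ⟨M⟩ := h.nonempty_geodesicModel
  exact (EarVertex.system _ (by omega) (by omega) le_rfl (by simp) (by simp)).false_of_odd_sun M
    ⟨k - 1, by omega⟩ (a := .extra 0) (b := .extra 1) (by simp [F12, earGraph])
    (by intro j hj; simp [EarVertex.system, F12, earGraph])
    (by intro j hj; simp [EarVertex.system, F12, earGraph])

theorem not_isBkEPG_F13 {k : ℕ} (hk : 2 ≤ k) : ¬ IsBkEPG 1 (F13 k) := by
  intro h
  obtain ⟨M⟩ := h.nonempty_geodesicModel
  exact (EarVertex.system _ (by omega) (by omega) (by omega) (by simp)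
    (by simp)).false_of_two_missing M hk (a := .extra 0) (b := .extra 1) (by simp [F13, earGraph])
    (by intro j hj; simp [EarVertex.system, F13, earGraph, Nat.mod_eq_of_lt hj])
    (by intro j hj; simp [EarVertex.system, F13, earGraph, Nat.mod_eq_of_lt hj])
    (by intro j hj; simp [EarVertex.system, F13, earGraph])
    (by intro j hj; simp [EarVertex.system, F13, earGraph])

theorem not_isBkEPG_F14 {k : ℕ} (hk : 2 ≤ k) : ¬ IsBkEPG 1 (F14 k) := by
  intro h
  obtain ⟨M⟩ := h.nonempty_geodesicModel
  exact (EarVertex.system _ (by omega) (by omega) (by omega) (by simp)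
    (by simp)).false_of_even_sun M hk (a := .extra 0)
    (by intro j hj; simp [EarVertex.system, F14, earGraph, Nat.mod_eq_of_lt hj])
    (by intro j hj; simp [EarVertex.system, F14, earGraph])

theorem not_isBkEPG_F15 {k : ℕ} (hk : 2 ≤ k) : ¬ IsBkEPG 1 (F15 k) := by
  intro h
  obtain ⟨M⟩ := h.nonempty_geodesicModel
  exact (EarVertex.system _ (by omega) (by omega) (by omega) (by simp)
    (by simp)).false_of_ends_missing M hk (a := .extra 0)
    (by intro j hj; simp [EarVertex.system, F15, earGraph, Nat.mod_eq_of_lt hj])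
    (by intro j hj; simp [EarVertex.system, F15, earGraph])

theorem not_isBkEPG_F16 {k : ℕ} (hk : 2 ≤ k) : ¬ IsBkEPG 1 (F16 k) := by
  intro h
  obtain ⟨M⟩ := h.nonempty_geodesicModel
  exact (EarVertex.system _ (by omega) (by omega) (by omega) (by simp)
    (by simp)).false_of_attached M hk (a := .extra 0) (b := .extra 1) (c := .extra 2)
    (d := .extra 3) (by simp [F16, earGraph]) (by simp [F16, earGraph]) (by simp [F16, earGraph])
    (by simp [F16, earGraph]) (by simp [F16, earGraph])
    (by intro j hj; simp [EarVertex.system, F16, earGraph])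
    (by intro j hj; simp [EarVertex.system, F16, earGraph])
    (by intro j hj; simp [EarVertex.system, F16, earGraph, Nat.mod_eq_of_lt hj])
    (by intro j hj; simp [EarVertex.system, F16, earGraph, Nat.mod_eq_of_lt hj])
    (by intro j hj; simp [EarVertex.system, F16, earGraph])
    (by intro j hj; simp [EarVertex.system, F16, earGraph])
    (by intro j hj; simp [EarVertex.system, F16, earGraph])
    (by intro j hj; simp [EarVertex.system, F16, earGraph])

/-! ### Cliques with three independent common neighbours -/

namespace GeodesicModel

variable {V : Type*} {G : SimpleGraph V}

/-- If all the vertices of a clique are adjacent to three independent vertices, then one of the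
three lies between the other two on all the paths of the clique. -/
theorem exists_common_middle (M : GeodesicModel G) {x y z : V}
    (hxy : x ≠ y ∧ ¬ G.Adj x y) (hyz : y ≠ z ∧ ¬ G.Adj y z) (hxz : x ≠ z ∧ ¬ G.Adj x z)
    (K : Set V) (hK : G.IsClique K) (hne : K.Nonempty)
    (hadj : ∀ v ∈ K, G.Adj v x ∧ G.Adj v y ∧ G.Adj v z) :
    (∀ v ∈ K, ∃ c : M.Chart v, c.Middle x y z) ∨ (∀ v ∈ K, ∃ c : M.Chart v, c.Middle y x z) ∨
      ∀ v ∈ K, ∃ c : M.Chart v, c.Middle z x y := by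
  obtain ⟨v, hv⟩ := hne
  obtain ⟨c⟩ := M.exists_chart v
  obtain ⟨vx, vy, vz⟩ := hadj v hv
  have key : ∀ {x y z}, x ≠ y ∧ ¬ G.Adj x y → x ≠ z ∧ ¬ G.Adj x z →
      (∀ v ∈ K, G.Adj v x ∧ G.Adj v y ∧ G.Adj v z) → c.Middle x y z →
      ∀ u ∈ K, ∃ c : M.Chart u, c.Middle x y z := by
    intro x y z hxy hxz hadj h u hu
    by_cases huv : v = u
    · subst huv
      exact ⟨c, h⟩
    · obtain ⟨d⟩ := M.exists_chart u
      obtain ⟨vx, vy, vz⟩ := hadj v hv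
      obtain ⟨ux, uy, uz⟩ := hadj u hu
      exact ⟨d, c.middle_of_middle d (hK hv hu huv) vx vy vz ux uy uz hxy hxz h⟩
  have symm : ∀ {u w}, u ≠ w ∧ ¬ G.Adj u w → w ≠ u ∧ ¬ G.Adj w u :=
    fun h => ⟨h.1.symm, fun h' => h.2 h'.symm⟩
  rcases c.middle_or vx vy vz hxy hyz hxz with h | h | h
  · exact Or.inl (key hxy hxz hadj h)
  · exact Or.inr (Or.inl (key (symm hxy) hyz
      (fun v hv => ⟨(hadj v hv).2.1, (hadj v hv).1, (hadj v hv).2.2⟩) h))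
  · exact Or.inr (Or.inr (key (symm hxz) (symm hyz)
      (fun v hv => ⟨(hadj v hv).2.2, (hadj v hv).1, (hadj v hv).2.1⟩) h))

/-- The common obstruction in the graphs `F8`, `F9` and `F10`. -/
theorem false_of_crossing (M : GeodesicModel G) {u v o x y a b : V} (huv : G.Adj u v)
    (hvo : G.Adj v o) (hvx : G.Adj v x) (hvy : G.Adj v y) (hva : G.Adj v a)
    (huo : G.Adj u o) (hux : G.Adj u x) (huy : G.Adj u y) (hub : G.Adj u b)
    (hxa : G.Adj x a) (hyb : G.Adj y b) (hua : u ≠ a ∧ ¬ G.Adj u a) (hvb : v ≠ b ∧ ¬ G.Adj v b)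
    (hox : o ≠ x ∧ ¬ G.Adj o x) (hoy : o ≠ y ∧ ¬ G.Adj o y) (hoa : o ≠ a ∧ ¬ G.Adj o a)
    (hob : o ≠ b ∧ ¬ G.Adj o b) (hxy : x ≠ y ∧ ¬ G.Adj x y) (hya : y ≠ a ∧ ¬ G.Adj y a)
    (hxb : x ≠ b ∧ ¬ G.Adj x b) (hside : ∀ c : M.Chart v, c.SameSide o x y)
    (hside' : ∀ c : M.Chart u, c.SameSide o y x) : False := by
  obtain ⟨c⟩ := M.exists_chart v
  obtain ⟨d⟩ := M.exists_chart u
  obtain ⟨r, ru, rv, ro⟩ := M.helly huv hvo huo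
  obtain ⟨s, t, sy, ty, sv, tv, su, tu, h1, h2⟩ := c.exists_nearer huv.symm hvo hvx hvy hva huo hux
    huy hxa hua hox hoy hoa hxy hya (hside c) rv ro ru
  obtain ⟨s', t', sx, tx, su', tu', sv', tv', h1', h2'⟩ := d.exists_nearer huv huo huy hux hub hvo
    hvy hvx hyb hvb hoy hox hob ⟨hxy.1.symm, fun h => hxy.2 h.symm⟩ hxb (hside' d) ru ro rv
  have := h2 s' sv' sx
  have := h2' s su sy
  omega

end GeodesicModel

/-! ### The remaining graphs -/

instance {n : ℕ} {l : List (ℕ × ℕ)} : DecidableRel (graphOfEdges n l).Adj :=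
  fun i j => decidable_of_iff (i ≠ j ∧ (((i : ℕ) + 1, (j : ℕ) + 1) ∈ l ∨
    ((j : ℕ) + 1, (i : ℕ) + 1) ∈ l)) (by simp [graphOfEdges])

theorem not_isBkEPG_F1 : ¬ IsBkEPG 1 F1 := by
  intro h
  obtain ⟨M⟩ := h.nonempty_geodesicModel
  obtain ⟨c⟩ := M.exists_chart 7
  -- This exposes `graphOfEdges`, so that `decide` can settle the adjacencies. The numerals of `Fin
  -- 8` are one less than the vertex labels.
  unfold F1 at c
  exact c.false_of_sameSide (x := 4) (y := 5) (z := 6) (by decide) (by decide) (by decide)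
    (c.sameSide_of_isChain (by decide) 5 [2, 0, 3, 6] (by decide) (by decide))
    (c.sameSide_of_isChain (by decide) 4 [1, 0, 3, 6] (by decide) (by decide))
    (c.sameSide_of_isChain (by decide) 4 [1, 0, 2, 5] (by decide) (by decide))

theorem not_isBkEPG_F2 : ¬ IsBkEPG 1 F2 := by
  intro h
  obtain ⟨M⟩ := h.nonempty_geodesicModel
  obtain ⟨c⟩ := M.exists_chart 6
  unfold F2 at c
  exact c.false_of_sameSide (x := 3) (y := 4) (z := 5) (by decide) (by decide) (by decide)
    (c.sameSide_of_isChain (by decide) 4 [2, 5] (by decide) (by decide))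
    (c.sameSide_of_isChain (by decide) 3 [0, 5] (by decide) (by decide))
    (c.sameSide_of_isChain (by decide) 3 [1, 4] (by decide) (by decide))

theorem not_isBkEPG_F3 : ¬ IsBkEPG 1 F3 := by
  intro h
  obtain ⟨M⟩ := h.nonempty_geodesicModel
  obtain ⟨c⟩ := M.exists_chart 7
  unfold F3 at c
  exact c.false_of_sameSide (x := 0) (y := 4) (z := 6) (by decide) (by decide) (by decide)
    (c.sameSide_of_isChain (by decide) 4 [3, 2, 6] (by decide) (by decide))
    (c.sameSide_of_isChain (by decide) 0 [1, 2, 6] (by decide) (by decide))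
    (c.sameSide_of_isChain (by decide) 0 [5, 4] (by decide) (by decide))

theorem not_isBkEPG_F4 : ¬ IsBkEPG 1 F4 := by
  intro h
  obtain ⟨M⟩ := h.nonempty_geodesicModel
  obtain ⟨c⟩ := M.exists_chart 7
  unfold F4 at c
  exact c.false_of_sameSide (x := 4) (y := 5) (z := 6) (by decide) (by decide) (by decide)
    (c.sameSide_of_isChain (by decide) 5 [2, 6] (by decide) (by decide))
    (c.sameSide_of_isChain (by decide) 4 [0, 3, 6] (by decide) (by decide))
    (c.sameSide_of_isChain (by decide) 4 [1, 5] (by decide) (by decide))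

/-- The two ends of the path and the pendant vertex form an asteroidal triple: the apex links the
pendant vertex to either end, and the path links the ends. -/
theorem not_isBkEPG_F5 {n : ℕ} (hn : 7 ≤ n) : ¬ IsBkEPG 1 (F5 n) := by
  intro h
  obtain ⟨M⟩ := h.nonempty_geodesicModel
  obtain ⟨c⟩ := M.exists_chart .universal
  let t : ℕ → F5Vertex n := fun i => .path ⟨i % (n - 3), Nat.mod_lt _ (by omega)⟩
  have ht : ∀ i (hi : i < n - 3), t i = .path ⟨i, hi⟩ := fun i hi => by
    simp [t, Nat.mod_eq_of_lt hi]
  have hu : ∀ i, (F5 n).Adj .universal (t i) := fun i => by simp [F5, t]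
  have ha : (F5 n).Adj .universal .apex := by simp [F5]
  have hp : (F5 n).Adj .universal .pendant := by simp [F5]
  have hap : (F5 n).Adj .apex .pendant := by simp [F5]
  have hat : ∀ i < n - 3, (F5 n).Adj (t i) .apex ↔ 0 < i ∧ i + 1 < n - 3 := fun i hi => by
    simp [F5, ht i hi]
  have htp : ∀ i, t i ≠ .pendant ∧ ¬ (F5 n).Adj (t i) .pendant := fun i => by simp [F5, t]
  have htt : ∀ i < n - 3, ∀ j < n - 3, (F5 n).Adj (t i) (t j) ↔ i + 1 = j ∨ j + 1 = i := by
    intro i hi j hj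
    simp only [F5, ht i hi, ht j hj, fromRel_adj, ne_eq, F5Vertex.path.injEq, Fin.mk.injEq]
    omega
  have hne : ∀ i < n - 3, ∀ j < n - 3, i ≠ j → t i ≠ t j := by
    intro i hi j hj hij
    simpa [ht i hi, ht j hj] using hij
  have nonadj : ∀ i < n - 3, ∀ j < n - 3, i + 1 < j ∨ j + 1 < i →
      t i ≠ t j ∧ ¬ (F5 n).Adj (t i) (t j) := by
    intro i hi j hj hij
    exact ⟨hne i hi j hj (by omega), by rw [htt i hi j hj]; omega⟩
  have symm : ∀ {u w}, u ≠ w ∧ ¬ (F5 n).Adj u w → w ≠ u ∧ ¬ (F5 n).Adj w u :=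
    fun h => ⟨h.1.symm, fun h' => h.2 h'.symm⟩
  have nat : ∀ i < n - 3, i = 0 ∨ i + 1 = n - 3 →
      F5Vertex.apex ≠ t i ∧ ¬ (F5 n).Adj .apex (t i) := by
    intro i hi h
    exact ⟨by simp [t], fun h' => absurd ((hat i hi).1 h'.symm) (by omega)⟩
  refine c.false_of_sameSide (x := t 0) (y := t (n - 4)) (z := .pendant) (hu _) (hu _) hp ?_ ?_ ?_
  · refine c.sameSide_of_isChain (hu _) (t (n - 4)) [t (n - 5), .apex, .pendant] ?_ ?_
    · simp [hap, (hat (n - 5) (by omega)).2 (by omega),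
        (htt (n - 4) (by omega) (n - 5) (by omega)).2 (by omega)]
    · simp only [List.forall_mem_cons]
      exact ⟨⟨hu _, nonadj _ (by omega) _ (by omega) (by omega)⟩,
        ⟨hu _, nonadj _ (by omega) _ (by omega) (by omega)⟩,
        ⟨ha, nat _ (by omega) (by omega)⟩, ⟨hp, symm (htp _)⟩, by simp⟩
  · refine c.sameSide_of_isChain (hu _) (t 0) [t 1, .apex, .pendant] ?_ ?_
    · simp [hap, (hat 1 (by omega)).2 (by omega), (htt 0 (by omega) 1 (by omega)).2 (by omega)]
    · simp only [List.forall_mem_cons]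
      exact ⟨⟨hu _, nonadj _ (by omega) _ (by omega) (by omega)⟩,
        ⟨hu _, nonadj _ (by omega) _ (by omega) (by omega)⟩,
        ⟨ha, nat _ (by omega) (by omega)⟩, ⟨hp, symm (htp _)⟩, by simp⟩
  · exact c.sameSide_of_seq hp t (n - 4)
      (fun i hi => (htt i (by omega) (i + 1) (by omega)).2 (by omega)) (fun i _ => ⟨hu i, htp i⟩)

theorem not_isBkEPG_F6 : ¬ IsBkEPG 1 F6 := by
  intro h
  obtain ⟨M⟩ := h.nonempty_geodesicModel
  unfold F6 at M
  rcases M.exists_common_middle (x := 2) (y := 3) (z := 4) (by decide) (by decide) (by decide)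
    {v | v = 0 ∨ v = 1} (by
      rintro u (rfl | rfl) v (rfl | rfl) h <;> first | exact absurd rfl h | decide)
    ⟨0, Or.inl rfl⟩ (by rintro u (rfl | rfl) <;> decide) with h | h | h
  · obtain ⟨c, hc⟩ := h 0 (Or.inl rfl)
    exact c.not_middle (u := 1) (w := 5) (by decide) (by decide) (by decide) (by decide)
      (by decide) (by decide) (by decide) (by decide) (by decide) (by decide) (by decide) hc
  · obtain ⟨c, hc⟩ := h 0 (Or.inl rfl)
    exact c.not_middle (u := 1) (w := 6) (by decide) (by decide) (by decide) (by decide)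
      (by decide) (by decide) (by decide) (by decide) (by decide) (by decide) (by decide) hc
  · obtain ⟨c, hc⟩ := h 1 (Or.inr rfl)
    exact c.not_middle (u := 0) (w := 7) (by decide) (by decide) (by decide) (by decide)
      (by decide) (by decide) (by decide) (by decide) (by decide) (by decide) (by decide) hc

theorem not_isBkEPG_F7 : ¬ IsBkEPG 1 F7 := by
  intro h
  obtain ⟨M⟩ := h.nonempty_geodesicModel
  unfold F7 at M
  rcases M.exists_common_middle (x := 3) (y := 4) (z := 5) (by decide) (by decide) (by decide)
    {v | v = 0 ∨ v = 1 ∨ v = 2} (by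
      rintro u (rfl | rfl | rfl) v (rfl | rfl | rfl) h <;> first | exact absurd rfl h | decide)
    ⟨0, Or.inl rfl⟩ (by rintro u (rfl | rfl | rfl) <;> decide) with h | h | h
  · obtain ⟨c, hc⟩ := h 1 (Or.inr (Or.inl rfl))
    exact c.not_middle (u := 0) (w := 6) (by decide) (by decide) (by decide) (by decide)
      (by decide) (by decide) (by decide) (by decide) (by decide) (by decide) (by decide) hc
  · obtain ⟨c, hc⟩ := h 0 (Or.inl rfl)
    exact c.not_middle (u := 1) (w := 7) (by decide) (by decide) (by decide) (by decide)
      (by decide) (by decide) (by decide) (by decide) (by decide) (by decide) (by decide) hc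
  · obtain ⟨c, hc⟩ := h 2 (Or.inr (Or.inr rfl))
    exact c.not_middle (u := 0) (w := 8) (by decide) (by decide) (by decide) (by decide)
      (by decide) (by decide) (by decide) (by decide) (by decide) (by decide) (by decide) hc

/-- The vertex `8` serves only to link `6` and `7` away from `1`, so its adjacency to `4` or `5`
plays no role. -/
theorem not_isBkEPG_F8 : ¬ IsBkEPG 1 F8 := by
  intro h
  obtain ⟨M⟩ := h.nonempty_geodesicModel
  unfold F8 at M
  refine M.false_of_crossing (v := 1) (u := 2) (o := 0) (x := 5) (y := 6) (a := 3) (b := 4)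
    ?_ ?_ ?_ ?_ ?_ ?_ ?_ ?_ ?_ ?_ ?_ ?_ ?_ ?_ ?_ ?_ ?_ ?_ ?_ ?_
    (fun c => c.sameSide_of_isChain (by decide) 5 [7, 6] (by decide) (by decide))
    (fun c => c.sameSide_of_isChain (by decide) 6 [7, 5] (by decide) (by decide)) <;> decide

theorem not_isBkEPG_F9 : ¬ IsBkEPG 1 F9 := by
  intro h
  obtain ⟨M⟩ := h.nonempty_geodesicModel
  unfold F9 at M
  refine M.false_of_crossing (v := 1) (u := 2) (o := 0) (x := 5) (y := 6) (a := 3) (b := 4)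
    ?_ ?_ ?_ ?_ ?_ ?_ ?_ ?_ ?_ ?_ ?_ ?_ ?_ ?_ ?_ ?_ ?_ ?_ ?_ ?_
    (fun c => c.sameSide_of_isChain (by decide) 5 [7, 6] (by decide) (by decide))
    (fun c => c.sameSide_of_isChain (by decide) 6 [7, 5] (by decide) (by decide)) <;> decide

theorem not_isBkEPG_F10 {n : ℕ} (hn : 8 ≤ n) : ¬ IsBkEPG 1 (F10 n) := by
  intro h
  obtain ⟨M⟩ := h.nonempty_geodesicModel
  let t : ℕ → F10Vertex n := fun i => .path ⟨i % (n - 5), Nat.mod_lt _ (by omega)⟩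
  have ht : ∀ i (hi : i < n - 5), t i = .path ⟨i, hi⟩ := fun i hi => by
    simp [t, Nat.mod_eq_of_lt hi]
  have hadj : ∀ i, i + 1 < n - 5 → (F10 n).Adj (t i) (t (i + 1)) := by
    intro i hi
    simp [F10, ht i (by omega), ht (i + 1) hi]
  have h2 : ∀ i, (F10 n).Adj .v2 (t i) := fun i => by simp [F10, t]
  have h3 : ∀ i, (F10 n).Adj .v3 (t i) := fun i => by simp [F10, t]
  have h1 : ∀ i, t i ≠ .v1 ∧ ¬ (F10 n).Adj (t i) .v1 := fun i => by simp [F10, t]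
  have e0 := ht 0 (by omega)
  have e1 := ht (n - 6) (by omega)
  have h12 : (F10 n).Adj .v2 .v1 := by simp [F10]
  have h13 : (F10 n).Adj .v3 .v1 := by simp [F10]
  have side : ∀ v, (F10 n).Adj v .v1 → (∀ i, (F10 n).Adj v (t i)) → ∀ c : M.Chart v,
      c.SameSide .v1 (t 0) (t (n - 6)) := fun v hv hvt c =>
    c.sameSide_of_seq hv t (n - 6) (fun i hi => hadj i (by omega)) (fun i _ => ⟨hvt i, h1 i⟩)
  have side' : ∀ v, (F10 n).Adj v .v1 → (∀ i, (F10 n).Adj v (t i)) → ∀ c : M.Chart v,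
      c.SameSide .v1 (t (n - 6)) (t 0) := fun v hv hvt c =>
    (side v hv hvt c).imp And.symm And.symm
  refine M.false_of_crossing (v := .v2) (u := .v3) (o := .v1) (x := t 0) (y := t (n - 6))
    (a := .v4) (b := .v5) ?_ h12 (h2 _) (h2 _) ?_ h13 (h3 _) (h3 _) ?_ ?_ ?_ ?_ ?_ ?_ ?_ ?_ ?_ ?_
    ?_ ?_ (side _ h12 h2) (side' _ h13 h3) <;>
    simp [F10, e0, e1] <;> omega

/-- No `B_1`-EPG graph contains one of the graphs `F₁`, …, `F₁₆` as an induced subgraph. -/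
theorem mainTheorem5 {V : Type*} (G : SimpleGraph V) (hG : IsBkEPG 1 G) :
    ¬ F1 ⊴ G ∧ ¬ F2 ⊴ G ∧ ¬ F3 ⊴ G ∧ ¬ F4 ⊴ G ∧ (∀ n, 7 ≤ n → ¬ F5 n ⊴ G) ∧
    ¬ F6 ⊴ G ∧ ¬ F7 ⊴ G ∧ ¬ F8 ⊴ G ∧ ¬ F9 ⊴ G ∧ (∀ n, 8 ≤ n → ¬ F10 n ⊴ G) ∧
    (∀ k, 2 ≤ k → ¬ F11 k ⊴ G) ∧ (∀ k, 2 ≤ k → ¬ F12 k ⊴ G) ∧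
    (∀ k, 2 ≤ k → ¬ F13 k ⊴ G) ∧ (∀ k, 2 ≤ k → ¬ F14 k ⊴ G) ∧
    (∀ k, 2 ≤ k → ¬ F15 k ⊴ G) ∧ (∀ k, 2 ≤ k → ¬ F16 k ⊴ G) :=
  ⟨fun h => not_isBkEPG_F1 (hG.of_isIndContained h),
    fun h => not_isBkEPG_F2 (hG.of_isIndContained h),
    fun h => not_isBkEPG_F3 (hG.of_isIndContained h),
    fun h => not_isBkEPG_F4 (hG.of_isIndContained h),
    fun _ hn h => not_isBkEPG_F5 hn (hG.of_isIndContained h),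
    fun h => not_isBkEPG_F6 (hG.of_isIndContained h),
    fun h => not_isBkEPG_F7 (hG.of_isIndContained h),
    fun h => not_isBkEPG_F8 (hG.of_isIndContained h),
    fun h => not_isBkEPG_F9 (hG.of_isIndContained h),
    fun _ hn h => not_isBkEPG_F10 hn (hG.of_isIndContained h),
    fun _ hk h => not_isBkEPG_F11 hk (hG.of_isIndContained h),
    fun _ hk h => not_isBkEPG_F12 hk (hG.of_isIndContained h),
    fun _ hk h => not_isBkEPG_F13 hk (hG.of_isIndContained h),
    fun _ hk h => not_isBkEPG_F14 hk (hG.of_isIndContained h),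
    fun _ hk h => not_isBkEPG_F15 hk (hG.of_isIndContained h),
    fun _ hk h => not_isBkEPG_F16 hk (hG.of_isIndContained h)⟩
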